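/- **Setting.** A distribution feeder has nodes $\mathcal N=\{0,\dots,N\}$ and lines $\mathcal E$ (unordered pairs of distinct nodes). Line $\{m,n\}$ has series admittance $y_{mn}=(R_{mn}+j\omega L_{mn})^{-1}$ (with $R_{mn}+j\omega L_{mn}\neq 0$) and shunt admittance $\bar y_{mn}=j\omega C_{mn}$. The admittance matrix $\mathbf Y$ has diagonal entries $\sum_{k:\{m,k\}\in\mathcal E}(\bar y_{mk}+y_{mk})$, off-diagonal entries $-y_{mn}$ on lines, and zeros elsewhere. With $\mathbf Y_n=\mathbf e_n\mathbf e_n^{T}\mathbf Y$ put $\mathbf Z_n=\frac12(\mathbf Y_n+\mathbf Y_n^{H})$, $\bar{\mathbf Z}_n=\frac j2(\mathbf Y_n-\mathbf Y_n^{H})$, $\mathbf M_n=\mathbf e_n\mathbf e_n^{T}$, and $\mathbf L=\sum_{\{m,n\}\in\mathcal E}\Re(y_{mn})(\mathbf e_m-\mathbf e_n)(\mathbf e_m-\mathbf e_n)^{T}$. Let $\mathcal U,\mathcal H\subset\mathcal N$ be the sets of poles and of houses with PV inverters. House $h$ has load $(P_{\ell,h},Q_{\ell,h})$, available active power $\bar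 P_h$, inverter rating $S_h$ and cost coefficients $a_h\ge 0$, $b_h\in\mathbb R$. Let $c_\rho\in\mathbb R$, $c_\phi\ge0$, $\lambda\ge 0$, and let $V^{\min},V^{\max}\in\mathbb R$ be the voltage limits. Put $\mathbf A_h=\mathrm{diag}(c_\phi a_h,0)$, $\mathbf b_h=[c_\phi b_h,0]^T$, $\mathbf d_h=[-2\bar P_h,0]^T$. The relaxed optimal inverter dispatch problem (P5), in the variables $\mathbf x_h=[P_{c,h},Q_{s,h}]^T\in\mathbb R^2$ $(h\in\mathcal H)$ and $\mathbf V\in\mathbb C^{(N+1)\times(N+1)}$ Hermitian, is $$\min\; c_\rho \mathrm{Tr}(\mathbf L\mathbf V)+\sum_{h\in\mathcal H}\big(\mathbf x_h^T\mathbf A_h\mathbf x_h+\mathbf b_h^T\mathbf x_h+\lambda\|\mathbf x_h\|_2\big)$$ subject to $\mathbf V\succeq0$ and - $\mathrm{Tr}(\mathbf Z_h\mathbf V)=-P_{\ell,h}+\bar P_h-P_{c,h}$ and $\mathrm{Tr}(\bar{\mathbf Z}_h\mathbf V)=-Q_{\ell,h}+Q_{s,h}$ for $h\in\mathcal H$;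 - $\mathrm{Tr}(\mathbf Z_u\mathbf V)=\mathrm{Tr}(\bar{\mathbf Z}_u\mathbf V)=0$ for $u\in\mathcal U$; - $(V^{\min})^2\le\mathrm{Tr}(\mathbf M_n\mathbf V)\le(V^{\max})^2$ for $n\in\mathcal N$; - $0\le P_{c,h}\le\bar P_h$ and $\mathbf x_h^T\mathbf x_h+\mathbf d_h^T\mathbf x_h+\bar P_h^2-S_h^2\le0$ for $h\in\mathcal H$. Assume Slater's condition: some feasible point has $\mathbf V\succ0$ and satisfies the quadratic inverter constraints strictly. Form the Lagrangian by dualizing all constraints except $\mathbf V\succeq0$. The multipliers are: $\mu_h,\bar\mu_h\in\mathbb R$ for the active and reactive balance at $h\in\mathcal H$, written as (left side) $-$ (right side) $=0$; free multipliers for the pole balances; nonnegative multipliers for the voltage limits; $\gamma_h\ge0$ for the quadratic constraint; $\nu_h\ge 0$ for $P_{c,h}\ge0$; and $\bar\nu_h\ge0$ for $P_{c,h}\le\bar P_h$. The dual function is the infimum of the Lagrangian over all $\{\mathbf x_h\}$ and all $\mathbf V\succeq0$. Optimal dual variables are its maximizers. **Claim.** Let $(\{\mathbf x_h^{\rm opt}\},\mathbf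 V^{\rm opt})$ be an optimal solution of (P5). Then optimal dual variables exist. For every choice of them, the duality gap is zero, $(\{\mathbf x_h^{\rm opt}\},\mathbf V^{\rm opt})$ minimizes the Lagrangian over all $\{\mathbf x_h\}$ and $\mathbf V\succeq 0$, and the following holds for each $h\in\mathcal H$. Put $$\mathbf Q_h=2\mathbf A_h+2\gamma_h\mathbf I_2,\qquad \mathbf c_h=\mathbf b_h+[\mu_h,-\bar\mu_h]^T+[\bar\nu_h-\nu_h,0]^T+\gamma_h\mathbf d_h .$$ 1. $\mathbf Q_h\succeq0$, and $\mathbf x_h^{\rm opt}$ is a global minimizer over $\mathbf x\in\mathbb R^2$ of $$\tfrac12\mathbf x^T\mathbf Q_h\mathbf x+\mathbf c_h^T\mathbf x+\lambda\|\mathbf x\|_2 .\qquad(*)$$ 2. Let $\lambda>0$. The scalar problem $$\min_{\eta\ge0}\ \eta-\tfrac{\eta}{2}\,\mathbf c_h^T\big(\eta\mathbf Q_h+\tfrac{\lambda^2}{2}\mathbf I_2\big)^{-1}\mathbf c_h$$ has a solution, and if $\|\mathbf c_h\|_2>\lambda$ its solution is unique and positive. For every solution $\eta$, the vector $$\hat{\mathbf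 x}_h=\mathbb I_{\{\|\mathbf c_h\|_2>\lambda\}}\Big[-\eta\big(\eta\mathbf Q_h+\tfrac{\lambda^2}{2}\mathbf I_2\big)^{-1}\mathbf c_h\Big]$$ is a global minimizer of $(*)$. 3. Let $\lambda>0$, and suppose that we are not in the degenerate tie $\|\mathbf c_h\|_2=\lambda,\ \mathbf Q_h\mathbf c_h=\mathbf 0$ (a tie that cannot occur when $\mathbf Q_h\succ0$). Then the minimizer of $(*)$ is unique, so $\mathbf x_h^{\rm opt}=\hat{\mathbf x}_h$. In particular, if moreover $\lambda\ge\|\mathbf c_h\|_2$, then $\mathbf x_h^{\rm opt}=\mathbf 0$ and the inverter operating point $(\bar P_h-P_{c,h},Q_{s,h})$ is $(\bar P_h,0)$. 4. If $\lambda>0$ and the degenerate tie does occur, the set of minimizers of $(*)$ is the ray $\{-t\,\mathbf c_h: t\ge0\}$. -/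

import Mathlib

/-- The data of the dispatch problem on a feeder with nodes `0, …, N`: the graph of lines with their
series resistance, series inductance and shunt capacitance, the angular frequency, the sets of
utility poles and of houses with PV inverters, the voltage limits, the loads, the available active
powers, the inverter ratings, and the coefficients of the cost.
The quantities `Pl, Ql, Pbar, S, a, b` matter only at the nodes of `H`. -/
structure DispatchData where
  N : ℕ
  G : SimpleGraph (Fin (N + 1))
  R : Sym2 (Fin (N + 1)) → ℝ
  Lind : Sym2 (Fin (N + 1)) → ℝ
  C : Sym2 (Fin (N + 1)) → ℝ
  ω : ℝ
  impedance_ne_zero : ∀ m n, G.Adj m n →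
    (R s(m, n) : ℂ) + Complex.I * (ω : ℂ) * (Lind s(m, n) : ℂ) ≠ 0
  U : Finset (Fin (N + 1))
  H : Finset (Fin (N + 1))
  Vmin : ℝ
  Vmax : ℝ
  Pl : Fin (N + 1) → ℝ
  Ql : Fin (N + 1) → ℝ
  Pbar : Fin (N + 1) → ℝ
  S : Fin (N + 1) → ℝ
  a : Fin (N + 1) → ℝ
  b : Fin (N + 1) → ℝ
  cρ : ℝ
  cφ : ℝ
  lam : ℝ

namespace DispatchData

noncomputable section

open Matrix
open scoped Classical ComplexOrder

/-- Complex square matrices indexed by the nodes. -/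
abbrev CMat (D : DispatchData) : Type := Matrix (Fin (D.N + 1)) (Fin (D.N + 1)) ℂ

/-- Real plane vectors `[P_c, Q_s]` with the Euclidean norm. -/
abbrev Vec2 : Type := EuclideanSpace ℝ (Fin 2)

/-- A family of inverter set points `x_h = [P_{c,h}, Q_{s,h}]`, `h ∈ H`. -/
abbrev SetPoints (D : DispatchData) : Type := {h // h ∈ D.H} → Vec2

variable (D : DispatchData)

/-- Series admittance `y_{mn} = (R_{mn} + j ω L_{mn})⁻¹`. -/
def y (m n : Fin (D.N + 1)) : ℂ :=
  ((D.R s(m, n) : ℂ) + Complex.I * (D.ω : ℂ) * (D.Lind s(m, n) : ℂ))⁻¹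

/-- Shunt admittance `j ω C_{mn}`. -/
def ysh (m n : Fin (D.N + 1)) : ℂ := Complex.I * (D.ω : ℂ) * (D.C s(m, n) : ℂ)

/-- The network admittance matrix. -/
def Y : D.CMat := Matrix.of fun m n =>
  if m = n then ∑ k, (if D.G.Adj m k then D.ysh m k + D.y m k else 0)
  else if D.G.Adj m n then - D.y m n
  else 0

/-- `M_n = e_n e_nᵀ`. -/
def M (n : Fin (D.N + 1)) : D.CMat := Matrix.single n n 1

/-- `Y_n = e_n e_nᵀ Y`. -/
def Yn (n : Fin (D.N + 1)) : D.CMat := D.M n * D.Y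

/-- `Z_n = (Y_n + Y_nᴴ) / 2`. -/
def Z (n : Fin (D.N + 1)) : D.CMat := (1 / 2 : ℂ) • (D.Yn n + (D.Yn n)ᴴ)

/-- `Zbar_n = (j / 2) (Y_n - Y_nᴴ)`. -/
def Zbar (n : Fin (D.N + 1)) : D.CMat := (Complex.I / 2) • (D.Yn n - (D.Yn n)ᴴ)

/-- `L_{mn} = Re(y_{mn}) (e_m - e_n)(e_m - e_n)ᵀ`. -/
def Lline (m n : Fin (D.N + 1)) : D.CMat :=
  (((D.y m n).re : ℝ) : ℂ) •
    vecMulVec (Pi.single m 1 - Pi.single n 1) (Pi.single m 1 - Pi.single n 1)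

/-- The loss matrix: the sum of `L_{mn}` over the lines, each line counted once. -/
def L : D.CMat := ∑ m, ∑ n, if m < n ∧ D.G.Adj m n then D.Lline m n else 0

/-- `Tr(X V)`, which is real for Hermitian `X` and `V`. -/
def tr (X V : D.CMat) : ℝ := (Matrix.trace (X * V)).re

/-- The quadratic form `xᵀ A x`. -/
def quad (A : Matrix (Fin 2) (Fin 2) ℝ) (x : Vec2) : ℝ := x.ofLp ⬝ᵥ (A *ᵥ x.ofLp)

/-- `A_h = diag(c_φ a_h, 0)`. -/
def A (h : Fin (D.N + 1)) : Matrix (Fin 2) (Fin 2) ℝ := Matrix.diagonal ![D.cφ * D.a h, 0]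

/-- `b_h = [c_φ b_h, 0]ᵀ`. -/
def bvec (h : Fin (D.N + 1)) : Vec2 := !₂[D.cφ * D.b h, 0]

/-- `d_h = [-2 Pbar_h, 0]ᵀ`. -/
def dvec (h : Fin (D.N + 1)) : Vec2 := !₂[-2 * D.Pbar h, 0]

/-- The objective
`c_ρ Tr(L V) + ∑_h (x_hᵀ A_h x_h + b_hᵀ x_h + λ ‖x_h‖₂)`. -/
def cost (x : D.SetPoints) (V : D.CMat) : ℝ :=
  D.cρ * D.tr D.L V +
    ∑ h : {h // h ∈ D.H}, (quad (D.A h) (x h) + (D.bvec h).ofLp ⬝ᵥ (x h).ofLp + D.lam * ‖x h‖)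

/-- The function `xᵀ x + d_hᵀ x + (Pbar_h² - S_h²)` of the apparent-power constraint. -/
def apparent (h : Fin (D.N + 1)) (x : Vec2) : ℝ :=
  x.ofLp ⬝ᵥ x.ofLp + (D.dvec h).ofLp ⬝ᵥ x.ofLp + (D.Pbar h ^ 2 - D.S h ^ 2)

/-- The feasible points of the relaxed dispatch problem. -/
structure Feasible (x : D.SetPoints) (V : D.CMat) : Prop where
  psd : V.PosSemidef
  active : ∀ h : {h // h ∈ D.H}, D.tr (D.Z h) V = - D.Pl h + D.Pbar h - x h 0
  reactive : ∀ h : {h // h ∈ D.H}, D.tr (D.Zbar h) V = - D.Ql h + x h 1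
  pole_active : ∀ u ∈ D.U, D.tr (D.Z u) V = 0
  pole_reactive : ∀ u ∈ D.U, D.tr (D.Zbar u) V = 0
  volt_lower : ∀ n, D.Vmin ^ 2 ≤ D.tr (D.M n) V
  volt_upper : ∀ n, D.tr (D.M n) V ≤ D.Vmax ^ 2
  curtail_lower : ∀ h : {h // h ∈ D.H}, 0 ≤ x h 0
  curtail_upper : ∀ h : {h // h ∈ D.H}, x h 0 ≤ D.Pbar h
  rating : ∀ h : {h // h ∈ D.H}, D.apparent h (x h) ≤ 0

/-- Globally optimal points of the relaxed dispatch problem. -/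
def IsOptimal (x : D.SetPoints) (V : D.CMat) : Prop :=
  D.Feasible x V ∧ ∀ x' V', D.Feasible x' V' → D.cost x V ≤ D.cost x' V'

/-- Slater's condition: some feasible point has `V` in the interior of the cone of positive
semidefinite matrices and satisfies the non-affine inequalities strictly. -/
def Slater : Prop :=
  ∃ (x : D.SetPoints) (V : D.CMat), D.Feasible x V ∧ V.PosDef ∧ ∀ h : {h // h ∈ D.H}, D.apparent h (x h) < 0

/-- Lagrange multipliers: `μ, μbar` of the active and reactive balance at the houses, `ξ, ξbar` of
the active and reactive balance at the poles, `φ, φbar` of the lower and upper voltage limits,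
`γ` of the apparent-power constraints, `ν, νbar` of the constraints `0 ≤ P_c` and `P_c ≤ Pbar`. -/
structure Multipliers where
  μ : {h // h ∈ D.H} → ℝ
  μbar : {h // h ∈ D.H} → ℝ
  ξ : {u // u ∈ D.U} → ℝ
  ξbar : {u // u ∈ D.U} → ℝ
  φ : Fin (D.N + 1) → ℝ
  φbar : Fin (D.N + 1) → ℝ
  γ : {h // h ∈ D.H} → ℝ
  ν : {h // h ∈ D.H} → ℝ
  νbar : {h // h ∈ D.H} → ℝ

variable {D}

/-- The multipliers of the inequality constraints are nonnegative. -/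
structure Multipliers.Nonneg (m : D.Multipliers) : Prop where
  φ : ∀ n, 0 ≤ m.φ n
  φbar : ∀ n, 0 ≤ m.φbar n
  γ : ∀ h, 0 ≤ m.γ h
  ν : ∀ h, 0 ≤ m.ν h
  νbar : ∀ h, 0 ≤ m.νbar h

/-- The Lagrangian; the constraint that `V` is positive semidefinite is not dualized. -/
def lagrangian (m : D.Multipliers) (x : D.SetPoints) (V : D.CMat) : ℝ :=
  D.cost x V
    + ∑ h : {h // h ∈ D.H}, m.μ h * (D.tr (D.Z h) V + D.Pl h - D.Pbar h + x h 0)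
    + ∑ h : {h // h ∈ D.H}, m.μbar h * (D.tr (D.Zbar h) V + D.Ql h - x h 1)
    + ∑ u : {u // u ∈ D.U}, m.ξ u * D.tr (D.Z u) V
    + ∑ u : {u // u ∈ D.U}, m.ξbar u * D.tr (D.Zbar u) V
    + ∑ n, m.φ n * (D.Vmin ^ 2 - D.tr (D.M n) V)
    + ∑ n, m.φbar n * (D.tr (D.M n) V - D.Vmax ^ 2)
    + ∑ h : {h // h ∈ D.H}, m.γ h * D.apparent h (x h)
    + ∑ h : {h // h ∈ D.H}, m.ν h * (- x h 0)
    + ∑ h : {h // h ∈ D.H}, m.νbar h * (x h 0 - D.Pbar h)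

/-- The dual function: the infimum of the Lagrangian over all `x` and all `V ⪰ 0`. -/
def dualFun (m : D.Multipliers) : EReal :=
  ⨅ (x : D.SetPoints) (V : D.CMat) (_ : V.PosSemidef), ((lagrangian m x V : ℝ) : EReal)

/-- `(x, V)` minimizes the Lagrangian over all `x` and all `V ⪰ 0`. -/
def MinimizesLagrangian (m : D.Multipliers) (x : D.SetPoints) (V : D.CMat) : Prop :=
  V.PosSemidef ∧ ∀ (x' : D.SetPoints) (V' : D.CMat), V'.PosSemidef →
    lagrangian m x V ≤ lagrangian m x' V'

/-- Optimal dual variables: the maximizers of the dual function. -/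
def IsDualOptimal (m : D.Multipliers) : Prop :=
  m.Nonneg ∧ ∀ m' : D.Multipliers, m'.Nonneg → dualFun m' ≤ dualFun m

/-- `Q_h = 2 A_h + 2 γ_h I`. -/
def Q (m : D.Multipliers) (h : {h // h ∈ D.H}) : Matrix (Fin 2) (Fin 2) ℝ :=
  (2 : ℝ) • D.A h + (2 * m.γ h) • (1 : Matrix (Fin 2) (Fin 2) ℝ)

/-- `c_h = b_h + [μ_h, -μbar_h] + [νbar_h - ν_h, 0] + γ_h d_h`. -/
def c (m : D.Multipliers) (h : {h // h ∈ D.H}) : Vec2 :=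
  D.bvec h + !₂[m.μ h, - m.μbar h] + !₂[m.νbar h - m.ν h, 0] + m.γ h • D.dvec h

/-- The objective `½ xᵀ Q x + cᵀ x + l ‖x‖₂` of the subproblem of one inverter. -/
def subObj (Q : Matrix (Fin 2) (Fin 2) ℝ) (c : Vec2) (l : ℝ) (x : Vec2) : ℝ :=
  1 / 2 * quad Q x + c.ofLp ⬝ᵥ x.ofLp + l * ‖x‖

/-- `x` is a global minimizer of the subproblem. -/
def IsSubMin (Q : Matrix (Fin 2) (Fin 2) ℝ) (c : Vec2) (l : ℝ) (x : Vec2) : Prop :=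
  ∀ z, subObj Q c l x ≤ subObj Q c l z

/-- The matrix `η Q + (l² / 2) I`. -/
def shrinkMat (Q : Matrix (Fin 2) (Fin 2) ℝ) (l η : ℝ) : Matrix (Fin 2) (Fin 2) ℝ :=
  η • Q + (l ^ 2 / 2) • (1 : Matrix (Fin 2) (Fin 2) ℝ)

/-- The scalar objective `η - (η / 2) cᵀ (η Q + (l² / 2) I)⁻¹ c`. -/
def scalarObj (Q : Matrix (Fin 2) (Fin 2) ℝ) (c : Vec2) (l η : ℝ) : ℝ :=
  η - η / 2 * (c.ofLp ⬝ᵥ ((shrinkMat Q l η)⁻¹ *ᵥ c.ofLp))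

/-- `η` solves the scalar problem of minimizing `scalarObj` over `η ≥ 0`. -/
def IsScalarSol (Q : Matrix (Fin 2) (Fin 2) ℝ) (c : Vec2) (l η : ℝ) : Prop :=
  0 ≤ η ∧ ∀ t, 0 ≤ t → scalarObj Q c l η ≤ scalarObj Q c l t

/-- The shrinkage and thresholding operation: `-η (η Q + (l² / 2) I)⁻¹ c` if `‖c‖₂ > l`,
and zero otherwise. -/
def shrink (Q : Matrix (Fin 2) (Fin 2) ℝ) (c : Vec2) (l η : ℝ) : Vec2 :=
  if l < ‖c‖ then WithLp.toLp 2 ((-η) • ((shrinkMat Q l η)⁻¹ *ᵥ c.ofLp)) else 0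

variable (D)

/-- The operating point `(Pbar_h - P_{c,h}, Q_{s,h})` of inverter `h`. -/
def operatingPoint (h : Fin (D.N + 1)) (x : Vec2) : ℝ × ℝ := (D.Pbar h - x 0, x 1)

end

end DispatchData

/-!
The Lagrange multipliers come from a refined form of Slater's theorem, and the statements about the
inverters from a closed analysis of the minimizers of `½ xᵀ Q x + cᵀ x + l ‖x‖`.

*Strong duality.* Only the apparent-power constraints are required to be strict at the Slater
point, while the balances and the limits on voltages and curtailment are affine and merely hold.
In `exists_lagrange_multipliers` the strict epigraph of the objective and of the convex constraints,
over an open convex set, is separated from the polyhedron of the affine constraints. The Slater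
point makes the separating hyperplane non-vertical, and Farkas' lemma, applied to the affine minorant
that it defines, produces the multipliers of the affine constraints. The cone of positive
semidefinite matrices has empty interior among all complex matrices, so `V` is parametrized as the
Hermitian part of an arbitrary matrix `W`. The matrices `W` with positive definite Hermitian part
form an open set, and semidefinite `V` are reached by the limit `V + ε I`. Weak duality
then turns the bound into the statements on all optimal dual variables, and since the Lagrangian is
separable, every `x h` minimizes its own subproblem.

*The subproblem.* If `z ≠ 0` is a minimizer, the bound `‖x‖ ≤ (‖x‖² / ‖z‖ + ‖z‖) / 2` shows that `z`
also minimizes a quadratic function, so that `(Q + (l / ‖z‖) I) z = -c`. With `η = l ‖z‖ / 2` this is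
the shrinkage formula `z = -η (η Q + (l² / 2) I)⁻¹ c`, and `‖z‖ = 2 η / l` says that the derivative of
the scalar objective vanishes at `η`. The matrix `Q` is diagonal, and an exact expression for the
gap of the scalar objective (`IsSubMin.scalarObj_sub`) shows that `η` is its only minimizer unless
`Q c = 0`. Comparing the equation for the derivative with its value at zero gives `l ≤ ‖c‖`, with
equality exactly if `Q c = 0` (`IsSubMin.le_norm`), which separates the threshold from the degenerate
tie. The existence of a minimizer is used throughout: without it the scalar objective may be
unbounded below when `Q` is singular.
-/

/-! ### Farkas' lemma and Lagrange multipliers -/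

section ConvexDuality

theorem convexOn_finset_sum {E ι : Type*} [AddCommGroup E] [Module ℝ E] {C : Set E}
    (hC : Convex ℝ C) (s : Finset ι) {f : ι → E → ℝ} (hf : ∀ i ∈ s, ConvexOn ℝ C (f i)) :
    ConvexOn ℝ C fun x => ∑ i ∈ s, f i x := by
  classical
  induction s using Finset.induction_on with
  | empty => simpa using convexOn_const 0 hC
  | insert i s hi ih =>
    simp only [Finset.sum_insert hi]
    exact (hf i (Finset.mem_insert_self i s)).add
      (ih fun j hj => hf j (Finset.mem_insert_of_mem hj))

/-- **Farkas' lemma** over an arbitrary real vector space. The induction composes the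
functionals with a projection onto the kernel of the one that is added last, so that no topology and
no closedness of finitely generated cones is involved. -/
theorem farkas_finset {E J : Type*} [AddCommGroup E] [Module ℝ E] (s : Finset J) :
    ∀ (α : J → E →ₗ[ℝ] ℝ) (q : E →ₗ[ℝ] ℝ),
      (∀ x, (∀ j ∈ s, α j x ≤ 0) → q x ≤ 0) →
      ∃ l : J → ℝ, (∀ j, 0 ≤ l j) ∧ ∀ x, q x = ∑ j ∈ s, l j * α j x := by
  classical
  induction s using Finset.induction_on with
  | empty =>
    intro α q h
    refine ⟨0, fun _ => le_rfl, fun x => ?_⟩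
    have h1 := h x (by simp)
    have h2 := h (-x) (by simp)
    rw [map_neg] at h2
    simp only [Finset.sum_empty]
    linarith
  | insert n s hn ih =>
    intro α q h
    by_cases hs : ∀ x, (∀ j ∈ s, α j x ≤ 0) → q x ≤ 0
    · obtain ⟨l, hl, hq⟩ := ih α q hs
      refine ⟨Function.update l n 0, fun j => ?_, fun x => ?_⟩
      · by_cases hj : j = n
        · subst hj; simp
        · simpa [hj] using hl j
      · rw [Finset.sum_insert hn, hq x]
        simp only [Function.update_self, zero_mul, zero_add]
        refine Finset.sum_congr rfl fun j hj => ?_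
        rw [Function.update_of_ne (ne_of_mem_of_not_mem hj hn)]
    · push Not at hs
      obtain ⟨x₁, hx₁, hqx₁⟩ := hs
      have hpos : 0 < α n x₁ := by
        by_contra hle
        refine absurd (h x₁ fun j hj => ?_) (not_le.2 hqx₁)
        rcases Finset.mem_insert.1 hj with rfl | hj
        · exact not_lt.1 hle
        · exact hx₁ j hj
      -- normalise so that the new functional takes the value one
      obtain ⟨x₀, hx₀, hq₀, hn₀⟩ :
          ∃ x₀, (∀ j ∈ s, α j x₀ ≤ 0) ∧ 0 < q x₀ ∧ α n x₀ = 1 := by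
        refine ⟨(α n x₁)⁻¹ • x₁, fun j hj => ?_, ?_, ?_⟩
        · simpa using mul_nonpos_of_nonneg_of_nonpos (inv_pos.2 hpos).le (hx₁ j hj)
        · simpa using mul_pos (inv_pos.2 hpos) hqx₁
        · simp [hpos.ne']
      obtain ⟨l, hl, hq⟩ := ih (fun j => α j - α j x₀ • α n) (q - q x₀ • α n) (by
        intro x hx
        have := h (x - α n x • x₀) (by
          intro j hj
          rcases Finset.mem_insert.1 hj with rfl | hj
          · simp [hn₀]
          · have := hx j hj
            simp only [LinearMap.sub_apply, LinearMap.smul_apply, smul_eq_mul, map_sub,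
              map_smul] at this ⊢
            linarith [mul_comm (α j x₀) (α n x)])
        simp only [LinearMap.sub_apply, LinearMap.smul_apply, smul_eq_mul, map_sub,
          map_smul] at this ⊢
        linarith [mul_comm (q x₀) (α n x)])
      have hsum : ∑ j ∈ s, l j * α j x₀ ≤ 0 :=
        Finset.sum_nonpos fun j hj => mul_nonpos_of_nonneg_of_nonpos (hl j) (hx₀ j hj)
      refine ⟨Function.update l n (q x₀ - ∑ j ∈ s, l j * α j x₀), fun j => ?_, fun x => ?_⟩
      · by_cases hj : j = n
        · subst hj; simp only [Function.update_self]; linarith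
        · simpa [hj] using hl j
      · rw [Finset.sum_insert hn]
        have h1 : ∑ j ∈ s, Function.update l n (q x₀ - ∑ j ∈ s, l j * α j x₀) j * α j x
            = ∑ j ∈ s, l j * α j x :=
          Finset.sum_congr rfl fun j hj => by
            rw [Function.update_of_ne (ne_of_mem_of_not_mem hj hn)]
        have h2 := hq x
        simp only [LinearMap.sub_apply, LinearMap.smul_apply, smul_eq_mul, mul_sub,
          Finset.sum_sub_distrib, ← mul_assoc, ← Finset.sum_mul] at h2
        rw [h1, Function.update_self]
        linarith [sub_mul (q x₀) (∑ j ∈ s, l j * α j x₀) (α n x)]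

/-- Farkas' lemma for affine functions: an affine function that is nonpositive on a nonempty
polyhedron is dominated by a combination of the constraints. It follows from the homogeneous
version on `E × ℝ`; nonemptiness handles the directions at infinity. -/
theorem affine_farkas {E J : Type*} [AddCommGroup E] [Module ℝ E] [Fintype J]
    (α : J → E →ₗ[ℝ] ℝ) (r : J → ℝ) (q : E →ₗ[ℝ] ℝ) (c : ℝ) (x₀ : E)
    (hx₀ : ∀ j, α j x₀ + r j ≤ 0) (h : ∀ x, (∀ j, α j x + r j ≤ 0) → q x + c ≤ 0) :
    ∃ l : J → ℝ, (∀ j, 0 ≤ l j) ∧ ∀ x, q x + c ≤ ∑ j, l j * (α j x + r j) := by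
  classical
  let β : Option J → (E × ℝ) →ₗ[ℝ] ℝ := fun o =>
    o.elim (-LinearMap.snd ℝ E ℝ)
      (fun j => (α j).comp (LinearMap.fst ℝ E ℝ) + r j • LinearMap.snd ℝ E ℝ)
  obtain ⟨l, hl, hq⟩ := farkas_finset Finset.univ β
    (q.comp (LinearMap.fst ℝ E ℝ) + c • LinearMap.snd ℝ E ℝ) (by
      rintro ⟨x, t⟩ hx
      have ht : 0 ≤ t := by simpa [β] using hx none (Finset.mem_univ _)
      have hα : ∀ j, α j x + r j * t ≤ 0 := fun j => by
        simpa [β] using hx (some j) (Finset.mem_univ _)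
      simp only [LinearMap.add_apply, LinearMap.comp_apply, LinearMap.fst_apply,
        LinearMap.smul_apply, LinearMap.snd_apply, smul_eq_mul]
      rcases ht.eq_or_lt with rfl | ht
      · -- `x` is a direction of recession: move along it from the feasible point `x₀`
        by_contra hcon
        simp only [mul_zero, add_zero, not_le] at hcon hα
        obtain ⟨n, hn⟩ := exists_nat_gt ((-(q x₀ + c)) / q x)
        rw [div_lt_iff₀ hcon] at hn
        have := h (x₀ + (n : ℝ) • x) (fun j => by
          have := mul_nonpos_of_nonneg_of_nonpos (Nat.cast_nonneg (α := ℝ) n) (hα j)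
          simp only [map_add, map_smul, smul_eq_mul]
          linarith [hx₀ j])
        simp only [map_add, map_smul, smul_eq_mul] at this
        linarith
      · have hti := inv_pos.2 ht
        have := h (t⁻¹ • x) (fun j => by
          have := mul_nonpos_of_nonneg_of_nonpos hti.le (hα j)
          rw [mul_add, mul_left_comm, inv_mul_cancel₀ ht.ne', mul_one] at this
          simpa using this)
        have h2 := mul_nonpos_of_nonneg_of_nonpos ht.le this
        rw [map_smul, smul_eq_mul, mul_add, ← mul_assoc, mul_inv_cancel₀ ht.ne', one_mul] at h2
        linarith)
  refine ⟨fun j => l (some j), fun j => hl _, fun x => ?_⟩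
  have := hq (x, 1)
  simp [β, Fintype.sum_option] at this
  linarith [hl none]

/-- `affine_farkas` with equality constraints, whose multipliers are free. -/
theorem affine_farkas_eq {E J K : Type*} [AddCommGroup E] [Module ℝ E] [Fintype J] [Fintype K]
    (α : J → E →ₗ[ℝ] ℝ) (r : J → ℝ) (ε : K → E →ₗ[ℝ] ℝ) (s : K → ℝ)
    (q : E →ₗ[ℝ] ℝ) (c : ℝ) (x₀ : E)
    (hx₀ : ∀ j, α j x₀ + r j ≤ 0) (hx₀' : ∀ k, ε k x₀ + s k = 0)
    (h : ∀ x, (∀ j, α j x + r j ≤ 0) → (∀ k, ε k x + s k = 0) → q x + c ≤ 0) :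
    ∃ (l : J → ℝ) (κ : K → ℝ), (∀ j, 0 ≤ l j) ∧
      ∀ x, q x + c ≤ ∑ j, l j * (α j x + r j) + ∑ k, κ k * (ε k x + s k) := by
  obtain ⟨l, hl, hq⟩ := affine_farkas (Sum.elim α (Sum.elim ε (fun k => -ε k)))
    (Sum.elim r (Sum.elim s (fun k => -s k))) q c x₀
    (by
      rintro (j | k | k)
      · exact hx₀ j
      · exact (hx₀' k).le
      · simp only [Sum.elim_inr, LinearMap.neg_apply]; linarith [hx₀' k])
    (fun x hx => h x (fun j => hx (.inl j)) fun k => by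
      have h1 := hx (.inr (.inl k))
      have h2 := hx (.inr (.inr k))
      simp only [Sum.elim_inr, Sum.elim_inl, LinearMap.neg_apply] at h1 h2
      linarith)
  refine ⟨fun j => l (.inl j), fun k => l (.inr (.inl k)) - l (.inr (.inr k)), fun j => hl _,
    fun x => (hq x).trans_eq ?_⟩
  simp only [Fintype.sum_sum_type, Sum.elim_inl, Sum.elim_inr, LinearMap.neg_apply]
  rw [← Finset.sum_add_distrib]
  congr 1
  exact Finset.sum_congr rfl fun k _ => by ring

/-- Existence of Lagrange multipliers for a convex program on an open convex set under the weak form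
of Slater's condition, in which only the constraints `g i ≤ 0` have to be strict.
The open set of all `(x, t, u)` with `f x < t` and `g i x < u i` is disjoint from the set of all
`(x, t, u)` with `x` in the polyhedron of the affine constraints, `t ≤ p` and `u ≤ 0`. A separating
hyperplane is not vertical because of the Slater point; it gives the multipliers of `g` and an
affine function to which Farkas' lemma applies. -/
theorem exists_lagrange_multipliers {E I J K : Type*} [AddCommGroup E] [Module ℝ E]
    [TopologicalSpace E] [IsTopologicalAddGroup E] [ContinuousSMul ℝ E]
    [Fintype I] [Fintype J] [Fintype K] {C : Set E} (hC : Convex ℝ C) (hCo : IsOpen C)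
    {f : E → ℝ} {g : I → E → ℝ} (hf : ConvexOn ℝ C f) (hfc : Continuous f)
    (hg : ∀ i, ConvexOn ℝ C (g i)) (hgc : ∀ i, Continuous (g i))
    (α : J → E →ₗ[ℝ] ℝ) (r : J → ℝ) (ε : K → E →ₗ[ℝ] ℝ) (s : K → ℝ) {p : ℝ}
    {x₀ : E} (hx₀C : x₀ ∈ C) (hg₀ : ∀ i, g i x₀ < 0)
    (hα₀ : ∀ j, α j x₀ + r j ≤ 0) (hε₀ : ∀ k, ε k x₀ + s k = 0)
    (hp : ∀ x ∈ C, (∀ i, g i x ≤ 0) → (∀ j, α j x + r j ≤ 0) → (∀ k, ε k x + s k = 0) → p ≤ f x) :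
    ∃ (γ : I → ℝ) (l : J → ℝ) (κ : K → ℝ), (∀ i, 0 ≤ γ i) ∧ (∀ j, 0 ≤ l j) ∧
      ∀ x ∈ C, p ≤ f x + ∑ i, γ i * g i x + ∑ j, l j * (α j x + r j)
        + ∑ k, κ k * (ε k x + s k) := by
  classical
  let A : Set (E × ℝ × (I → ℝ)) := {z | z.1 ∈ C ∧ f z.1 < z.2.1 ∧ ∀ i, g i z.1 < z.2.2 i}
  let B : Set (E × ℝ × (I → ℝ)) :=
    {z | (∀ j, α j z.1 + r j ≤ 0) ∧ (∀ k, ε k z.1 + s k = 0) ∧ z.2.1 ≤ p ∧ ∀ i, z.2.2 i ≤ 0}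
  have hA : Convex ℝ A := by
    rintro ⟨x, t, u⟩ ⟨hx, ht, hu⟩ ⟨x', t', u'⟩ ⟨hx', ht', hu'⟩ a b ha hb hab
    refine ⟨hC hx hx' ha hb hab, ?_, fun i => ?_⟩
    · refine (hf.2 hx hx' ha hb hab).trans_lt ?_
      have := convex_Ioi (0 : ℝ) (sub_pos.2 ht) (sub_pos.2 ht') ha hb hab
      simp only [smul_eq_mul, Set.mem_Ioi, Prod.smul_mk, Prod.mk_add_mk] at this ⊢
      linarith
    · refine ((hg i).2 hx hx' ha hb hab).trans_lt ?_
      have := convex_Ioi (0 : ℝ) (sub_pos.2 (hu i)) (sub_pos.2 (hu' i)) ha hb hab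
      simp only [smul_eq_mul, Set.mem_Ioi, Prod.smul_mk, Prod.mk_add_mk, Pi.add_apply,
        Pi.smul_apply] at this ⊢
      linarith
  have hAo : IsOpen A := by
    refine (hCo.preimage continuous_fst).inter (IsOpen.inter ?_ ?_)
    · exact isOpen_lt (hfc.comp continuous_fst) (continuous_fst.comp continuous_snd)
    · have : {z : E × ℝ × (I → ℝ) | ∀ i, g i z.1 < z.2.2 i} = ⋂ i, {z | g i z.1 < z.2.2 i} := by
        ext; simp
      change IsOpen {z : E × ℝ × (I → ℝ) | ∀ i, g i z.1 < z.2.2 i}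
      rw [this]
      exact isOpen_iInter_of_finite fun i => isOpen_lt ((hgc i).comp continuous_fst)
        ((continuous_apply i).comp (continuous_snd.comp continuous_snd))
  have hB : Convex ℝ B := by
    rintro ⟨x, t, u⟩ ⟨hx, hx2, ht, hu⟩ ⟨x', t', u'⟩ ⟨hx', hx2', ht', hu'⟩ a b ha hb hab
    have key : ∀ v w : ℝ, v ≤ 0 → w ≤ 0 → a * v + b * w ≤ 0 := fun v w hv hw => by
      linarith [mul_nonpos_of_nonneg_of_nonpos ha hv, mul_nonpos_of_nonneg_of_nonpos hb hw]
    refine ⟨fun j => ?_, fun k => ?_, ?_, fun i => key _ _ (hu i) (hu' i)⟩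
    · have := key _ _ (hx j) (hx' j)
      simp only [Prod.smul_mk, Prod.mk_add_mk, map_add, map_smul, smul_eq_mul] at this ⊢
      linear_combination this - (r j) * hab
    · have h1 := hx2 k
      have h2 := hx2' k
      simp only [Prod.smul_mk, Prod.mk_add_mk, map_add, map_smul, smul_eq_mul] at h1 h2 ⊢
      linear_combination a * h1 + b * h2 - (s k) * hab
    · have := key (t - p) (t' - p) (by simpa using ht) (by simpa using ht')
      simp only [Prod.smul_mk, Prod.mk_add_mk, smul_eq_mul]
      linear_combination this + p * hab
  have hAB : Disjoint A B := by
    rw [Set.disjoint_left]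
    rintro ⟨x, t, u⟩ ⟨hx, ht, hu⟩ ⟨h1, h2, h3, h4⟩
    have := hp x hx (fun i => ((hu i).trans_le (h4 i)).le) h1 h2
    exact absurd (ht.trans_le h3) (not_lt.2 this)
  obtain ⟨φ, c, hφA, hφB⟩ := geometric_hahn_banach_open hA hAo hB hAB
  let ℓ : E →ₗ[ℝ] ℝ := φ.toLinearMap.comp (LinearMap.inl ℝ E (ℝ × (I → ℝ)))
  let τ : ℝ := φ (0, 1, 0)
  let γ : I → ℝ := fun i => φ (0, 0, Pi.single i 1)
  have hφ : ∀ x t u, φ (x, t, u) = ℓ x + t * τ + ∑ i, u i * γ i := by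
    intro x t u
    have h1 : (x, t, u) = (x, 0, 0) + t • ((0, 1, 0) : E × ℝ × (I → ℝ))
        + ∑ i, u i • ((0, 0, Pi.single i 1) : E × ℝ × (I → ℝ)) := by
      ext1
      · simp [Prod.fst_sum]
      · ext1
        · simp [Prod.fst_sum, Prod.snd_sum]
        · ext i
          simp [Prod.snd_sum, Finset.sum_apply, Pi.single_apply]
    rw [h1, map_add, map_add, map_smul, map_sum]
    simp only [map_smul, smul_eq_mul]
    rfl
  have hτ : τ < 0 := by
    have h1 := hφA (x₀, max (f x₀) p + 1, 0)
      ⟨hx₀C, (le_max_left _ _).trans_lt (lt_add_one _), hg₀⟩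
    have h2 := hφB (x₀, p, 0) ⟨hα₀, hε₀, le_rfl, fun _ => le_rfl⟩
    rw [hφ] at h1 h2
    have h3 : p < max (f x₀) p + 1 := (le_max_right _ _).trans_lt (lt_add_one _)
    by_contra hcon
    have := mul_le_mul_of_nonneg_right h3.le (not_lt.1 hcon)
    linarith
  have hγ : ∀ i, γ i ≤ 0 := by
    intro i
    by_contra! hcon
    obtain ⟨n, hn⟩ := exists_nat_gt ((c - ℓ x₀ - (f x₀ + 1) * τ) / γ i)
    rw [div_lt_iff₀ hcon] at hn
    have h1 := hφA (x₀, f x₀ + 1, Pi.single i (n : ℝ))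
      ⟨hx₀C, lt_add_one _, fun j => (hg₀ j).trans_le (by
        by_cases hj : j = i
        · subst hj; simp
        · simp [hj])⟩
    rw [hφ] at h1
    simp only [Pi.single_apply, ite_mul, zero_mul, Finset.sum_ite_eq', Finset.mem_univ,
      if_true] at h1
    linarith
  have hupper : ∀ x ∈ C, ℓ x + f x * τ + ∑ i, g i x * γ i ≤ c := by
    intro x hx
    by_contra! hcon
    have hD : 0 < -(τ + ∑ i, γ i) := by
      have := Finset.sum_nonpos fun i (_ : i ∈ Finset.univ) => hγ i
      linarith
    set X := ℓ x + f x * τ + ∑ i, g i x * γ i with hX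
    have hδ : 0 < (X - c) / -(τ + ∑ i, γ i) := div_pos (sub_pos.2 hcon) hD
    set δ := (X - c) / -(τ + ∑ i, γ i) with hδd
    have h1 := hφA (x, f x + δ, fun i => g i x + δ)
      ⟨hx, lt_add_of_pos_right _ hδ, fun i => lt_add_of_pos_right _ hδ⟩
    rw [hφ] at h1
    simp only [add_mul, Finset.sum_add_distrib, ← Finset.mul_sum] at h1
    have h2 : δ * -(τ + ∑ i, γ i) = X - c := div_mul_cancel₀ _ hD.ne'
    linarith
  obtain ⟨l, κ, hl, hlκ⟩ := affine_farkas_eq α r ε s (-ℓ) (c - p * τ) x₀ hα₀ hε₀ (by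
    intro x h1 h2
    have h3 := hφB (x, p, 0) ⟨h1, h2, le_rfl, fun _ => le_rfl⟩
    rw [hφ] at h3
    simp only [Pi.zero_apply, zero_mul, Finset.sum_const_zero, LinearMap.neg_apply] at h3 ⊢
    linarith)
  have hT : 0 < -τ := neg_pos.2 hτ
  refine ⟨fun i => -γ i / -τ, fun j => l j / -τ, fun k => κ k / -τ,
    fun i => div_nonneg (neg_nonneg.2 (hγ i)) hT.le, fun j => div_nonneg (hl j) hT.le,
    fun x hx => ?_⟩
  have h1 := hupper x hx
  have h2 := hlκ x
  rw [LinearMap.neg_apply] at h2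
  simp only [div_mul_eq_mul_div, ← Finset.sum_div]
  have h3 : f x = f x * -τ / -τ := (mul_div_cancel_right₀ _ hT.ne').symm
  rw [h3, ← add_div, ← add_div, ← add_div, le_div_iff₀ hT]
  have h4 : ∑ i, -γ i * g i x = -∑ i, g i x * γ i := by
    rw [← Finset.sum_neg_distrib]
    exact Finset.sum_congr rfl fun i _ => by ring
  rw [h4]
  linarith

end ConvexDuality

/-! ### Hermitian parts and positive definite matrices -/

section HermitianPart

open Matrix Topology
open scoped ComplexOrder

variable {n : Type*}

/-- The Hermitian part `(W + Wᴴ) / 2` of a complex matrix. It parametrizes the Hermitian matrices by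
the whole matrix space, in which the positive definite ones then correspond to an open set. -/
noncomputable def hermPart : Matrix n n ℂ →ₗ[ℝ] Matrix n n ℂ where
  toFun W := (1 / 2 : ℝ) • (W + Wᴴ)
  map_add' W W' := by rw [conjTranspose_add, ← smul_add]; congr 1; abel
  map_smul' r W := by
    rw [conjTranspose_smul, RingHom.id_apply, smul_comm r, star_trivial, smul_add r]

theorem hermPart_apply (W : Matrix n n ℂ) : hermPart W = (1 / 2 : ℝ) • (W + Wᴴ) := rfl

theorem hermPart_of_isHermitian {W : Matrix n n ℂ} (hW : W.IsHermitian) : hermPart W = W := by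
  rw [hermPart_apply, hW.eq, ← two_smul ℝ W, smul_smul]
  norm_num

theorem isHermitian_hermPart (W : Matrix n n ℂ) : (hermPart W).IsHermitian := by
  rw [hermPart_apply, IsHermitian, conjTranspose_smul, conjTranspose_add,
    conjTranspose_conjTranspose, add_comm, star_trivial]

theorem continuous_hermPart : Continuous (hermPart : Matrix n n ℂ → Matrix n n ℂ) := by
  change Continuous fun W : Matrix n n ℂ => (1 / 2 : ℝ) • (W + Wᴴ)
  fun_prop

/-- By homogeneity, positive definiteness only has to be tested on the unit sphere. -/
theorem posDef_iff_sphere [Fintype n] {A : Matrix n n ℂ} (hA : A.IsHermitian) :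
    A.PosDef ↔ ∀ v ∈ Metric.sphere (0 : n → ℂ) 1, 0 < (star v ⬝ᵥ (A *ᵥ v)).re := by
  rw [posDef_iff_dotProduct_mulVec]
  constructor
  · rintro ⟨-, h⟩ v hv
    exact (Complex.pos_iff.1 (h (by rintro rfl; simp at hv))).1
  · refine fun h => ⟨hA, fun v hv => Complex.pos_iff.2 ⟨?_, ?_⟩⟩
    · have hn : 0 < ‖v‖ := norm_pos_iff.2 hv
      have h1 := h ((‖v‖⁻¹ : ℝ) • v) (by
        rw [mem_sphere_zero_iff_norm, norm_smul, norm_inv, norm_norm, inv_mul_cancel₀ hn.ne'])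
      rw [mulVec_smul, star_smul, smul_dotProduct, dotProduct_smul, star_trivial,
        Complex.smul_re, Complex.smul_re, smul_eq_mul, smul_eq_mul] at h1
      have hi := inv_pos.2 hn
      exact pos_of_mul_pos_right (pos_of_mul_pos_right h1 hi.le) hi.le
    · exact (hA.im_star_dotProduct_mulVec_self v).symm

theorem isOpen_setOf_posDef_hermPart [Fintype n] : IsOpen {W : Matrix n n ℂ | (hermPart W).PosDef} := by
  have h : {W : Matrix n n ℂ | (hermPart W).PosDef} =
      {W | ∀ v ∈ Metric.sphere (0 : n → ℂ) 1, 0 < (star v ⬝ᵥ (hermPart W *ᵥ v)).re} := by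
    ext W
    exact posDef_iff_sphere (isHermitian_hermPart W)
  have hcont : Continuous fun z : Matrix n n ℂ × (n → ℂ) =>
      (star z.2 ⬝ᵥ (hermPart z.1 *ᵥ z.2)).re := by
    refine Complex.continuous_re.comp (Continuous.dotProduct (by fun_prop) ?_)
    exact (continuous_hermPart.comp continuous_fst).matrix_mulVec continuous_snd
  rw [h, isOpen_iff_mem_nhds]
  intro W hW
  exact (isCompact_sphere (0 : n → ℂ) 1).eventually_forall_of_forall_eventually fun v hv =>
    (isOpen_lt continuous_const hcont).mem_nhds (hW v hv)

theorem convex_setOf_posDef : Convex ℝ {A : Matrix n n ℂ | A.PosDef} := by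
  intro A hA B hB a b ha hb hab
  rcases ha.eq_or_lt with rfl | ha
  · obtain rfl : b = 1 := by linarith
    simpa using hB
  · exact (hA.smul ha).add_posSemidef (hB.posSemidef.smul hb)

end HermitianPart

/-! ### Strong duality for the dispatch problem -/

namespace DispatchData

section Duality

open Matrix Topology
open scoped ComplexOrder

variable (D : DispatchData)

/-- The function `V ↦ Re Tr(X V)` as a real linear map. -/
noncomputable def trLin (X : D.CMat) : D.CMat →ₗ[ℝ] ℝ where
  toFun := D.tr X
  map_add' V W := by simp [tr, Matrix.mul_add]
  map_smul' r V := by simp [tr]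

theorem continuous_tr (X : D.CMat) : Continuous (D.tr X) := by
  unfold tr
  fun_prop

/-- The coordinate `i` of the set point of house `h`, as a linear map. -/
def coordLin (h : {h // h ∈ D.H}) (i : Fin 2) : D.SetPoints × D.CMat →ₗ[ℝ] ℝ where
  toFun z := z.1 h i
  map_add' _ _ := rfl
  map_smul' _ _ := rfl

@[simp]
theorem coordLin_apply (h : {h // h ∈ D.H}) (i : Fin 2) (z : D.SetPoints × D.CMat) :
    D.coordLin h i z = z.1 h i := rfl

/-- `Tr(X V)` for the Hermitian part `V` of the second component, as a linear map. -/
noncomputable def trHerm (X : D.CMat) : D.SetPoints × D.CMat →ₗ[ℝ] ℝ :=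
  (D.trLin X).comp (hermPart.comp (LinearMap.snd ℝ D.SetPoints D.CMat))

@[simp]
theorem trHerm_apply (X : D.CMat) (z : D.SetPoints × D.CMat) :
    D.trHerm X z = D.tr X (hermPart z.2) := rfl

theorem quad_A (h : Fin (D.N + 1)) (x : Vec2) : quad (D.A h) x = D.cφ * D.a h * x 0 ^ 2 := by
  simp [quad, A, mulVec_diagonal, dotProduct, Fin.sum_univ_two]
  ring

theorem apparent_eq (h : Fin (D.N + 1)) (x : Vec2) :
    D.apparent h x = x 0 ^ 2 + x 1 ^ 2 - 2 * D.Pbar h * x 0 + (D.Pbar h ^ 2 - D.S h ^ 2) := by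
  simp [apparent, dvec, dotProduct, Fin.sum_univ_two]
  ring

theorem convexOn_coord_sq (h : {h // h ∈ D.H}) (i : Fin 2) :
    ConvexOn ℝ Set.univ fun z : D.SetPoints × D.CMat => z.1 h i ^ 2 :=
  (even_two.convexOn_pow (𝕜 := ℝ)).comp_linearMap (D.coordLin h i)

theorem convexOn_cost (hcφ : 0 ≤ D.cφ) (ha : ∀ h ∈ D.H, 0 ≤ D.a h) (hlam : 0 ≤ D.lam) :
    ConvexOn ℝ Set.univ fun z : D.SetPoints × D.CMat => D.cost z.1 (hermPart z.2) := by
  refine ConvexOn.add ?_ (convexOn_finset_sum convex_univ _ fun h _ =>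
    ConvexOn.add (ConvexOn.add ?_ ?_) ?_)
  · exact (D.cρ • D.trHerm D.L).convexOn convex_univ
  · simp only [quad_A]
    exact (D.convexOn_coord_sq h 0).smul (mul_nonneg hcφ (ha h h.2))
  · refine ((D.cφ * D.b h) • D.coordLin h 0).convexOn convex_univ |>.congr fun z _ => ?_
    simp [bvec, dotProduct, Fin.sum_univ_two]
  · exact (convexOn_univ_norm.comp_linearMap
      ((LinearMap.proj h).comp (LinearMap.fst ℝ D.SetPoints D.CMat))).smul hlam

theorem convexOn_apparent (h : {h // h ∈ D.H}) :
    ConvexOn ℝ Set.univ fun z : D.SetPoints × D.CMat => D.apparent h (z.1 h) := by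
  refine ((((D.convexOn_coord_sq h 0).add (D.convexOn_coord_sq h 1)).add
    (((-(2 * D.Pbar h)) • D.coordLin h 0).convexOn convex_univ)).add
    (convexOn_const (D.Pbar h ^ 2 - D.S h ^ 2) convex_univ)).congr fun z _ => ?_
  simp [apparent_eq]
  ring

theorem continuous_cost :
    Continuous fun z : D.SetPoints × D.CMat => D.cost z.1 (hermPart z.2) := by
  refine Continuous.add (continuous_const.mul ((D.continuous_tr _).comp
    (continuous_hermPart.comp continuous_snd))) (continuous_finsetSum _ fun h _ => ?_)
  simp only [quad_A, bvec, dotProduct, Fin.sum_univ_two]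
  fun_prop

theorem continuous_apparent (h : {h // h ∈ D.H}) :
    Continuous fun z : D.SetPoints × D.CMat => D.apparent h (z.1 h) := by
  simp only [apparent_eq]
  fun_prop

theorem continuous_lagrangian_right (m : D.Multipliers) (x : D.SetPoints) :
    Continuous fun V => lagrangian m x V := by
  have := D.continuous_tr
  unfold lagrangian cost
  fun_prop

/-- Under Slater's condition some nonnegative multipliers close the duality gap. The general
multiplier theorem gives the bound for positive definite `V`; it extends to the positive
semidefinite ones by continuity along `V + ε I`. -/
theorem exists_multipliers_cost_le_lagrangian
    (hcφ : 0 ≤ D.cφ) (ha : ∀ h ∈ D.H, 0 ≤ D.a h) (hlam : 0 ≤ D.lam) (hSlater : D.Slater)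
    {x : D.SetPoints} {V : D.CMat} (hopt : D.IsOptimal x V) :
    ∃ m : D.Multipliers, m.Nonneg ∧
      ∀ x' V', V'.PosSemidef → D.cost x V ≤ lagrangian m x' V' := by
  obtain ⟨x₀, V₀, hfeas, hpd, hstrict⟩ := hSlater
  have hV₀ : hermPart V₀ = V₀ := hermPart_of_isHermitian hpd.isHermitian
  let C : Set (D.SetPoints × D.CMat) := {z | (hermPart z.2).PosDef}
  have hC : Convex ℝ C := convex_setOf_posDef.linear_preimage
    ((hermPart : D.CMat →ₗ[ℝ] D.CMat).comp (LinearMap.snd ℝ D.SetPoints D.CMat))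
  have hCo : IsOpen C := isOpen_setOf_posDef_hermPart.preimage continuous_snd
  -- the inequalities are the lower and upper voltage and curtailment limits, the equalities the
  -- active and reactive balances of the houses and of the poles
  let α : Fin (D.N + 1) ⊕ Fin (D.N + 1) ⊕ {h // h ∈ D.H} ⊕ {h // h ∈ D.H} →
      (D.SetPoints × D.CMat →ₗ[ℝ] ℝ) :=
    Sum.elim (fun n => -D.trHerm (D.M n)) (Sum.elim (fun n => D.trHerm (D.M n))
      (Sum.elim (fun h => -D.coordLin h 0) (fun h => D.coordLin h 0)))
  let r : Fin (D.N + 1) ⊕ Fin (D.N + 1) ⊕ {h // h ∈ D.H} ⊕ {h // h ∈ D.H} → ℝ :=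
    Sum.elim (fun _ => D.Vmin ^ 2) (Sum.elim (fun _ => -D.Vmax ^ 2)
      (Sum.elim (fun _ => 0) (fun h => -D.Pbar h)))
  let ε : {h // h ∈ D.H} ⊕ {h // h ∈ D.H} ⊕ {u // u ∈ D.U} ⊕ {u // u ∈ D.U} →
      (D.SetPoints × D.CMat →ₗ[ℝ] ℝ) :=
    Sum.elim (fun h => D.trHerm (D.Z h) + D.coordLin h 0)
      (Sum.elim (fun h => D.trHerm (D.Zbar h) - D.coordLin h 1)
      (Sum.elim (fun u => D.trHerm (D.Z u)) (fun u => D.trHerm (D.Zbar u))))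
  let s : {h // h ∈ D.H} ⊕ {h // h ∈ D.H} ⊕ {u // u ∈ D.U} ⊕ {u // u ∈ D.U} → ℝ :=
    Sum.elim (fun h => D.Pl h - D.Pbar h) (Sum.elim (fun h => D.Ql h)
      (Sum.elim (fun _ => 0) (fun _ => 0)))
  obtain ⟨γ, l, κ, hγ, hl, hle⟩ := exists_lagrange_multipliers hC hCo
    ((D.convexOn_cost hcφ ha hlam).subset (Set.subset_univ C) hC) D.continuous_cost
    (fun h => (D.convexOn_apparent h).subset (Set.subset_univ C) hC) D.continuous_apparent
    α r ε s (p := D.cost x V) (x₀ := (x₀, V₀)) (by simpa only [C, Set.mem_ofPred, hV₀] using hpd)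
    hstrict
    (by
      rintro (n | n | h | h)
      · have := hfeas.volt_lower n
        simp only [α, r, Sum.elim_inl, LinearMap.neg_apply, trHerm_apply, hV₀]; linarith
      · have := hfeas.volt_upper n
        simp only [α, r, Sum.elim_inl, Sum.elim_inr, trHerm_apply, hV₀]; linarith
      · have := hfeas.curtail_lower h
        simp only [α, r, Sum.elim_inl, Sum.elim_inr, LinearMap.neg_apply, coordLin_apply]
        linarith
      · have := hfeas.curtail_upper h
        simp only [α, r, Sum.elim_inr, coordLin_apply]; linarith)
    (by
      rintro (h | h | u | u)
      · have := hfeas.active h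
        simp only [ε, s, Sum.elim_inl, LinearMap.add_apply, trHerm_apply, coordLin_apply, hV₀]
        linarith
      · have := hfeas.reactive h
        simp only [ε, s, Sum.elim_inl, Sum.elim_inr, LinearMap.sub_apply, trHerm_apply,
          coordLin_apply, hV₀]
        linarith
      · have := hfeas.pole_active u u.2
        simp only [ε, s, Sum.elim_inl, Sum.elim_inr, trHerm_apply, hV₀]; linarith
      · have := hfeas.pole_reactive u u.2
        simp only [ε, s, Sum.elim_inr, trHerm_apply, hV₀]; linarith)
    (by
      rintro ⟨x', W⟩ hW hg hα hε
      refine hopt.2 x' (hermPart W) ⟨hW.posSemidef, fun h => ?_, fun h => ?_, fun u hu => ?_,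
        fun u hu => ?_, fun n => ?_, fun n => ?_, fun h => ?_, fun h => ?_, hg⟩
      · have := hε (.inl h)
        simp only [ε, s, Sum.elim_inl, LinearMap.add_apply, trHerm_apply, coordLin_apply] at this
        linarith
      · have := hε (.inr (.inl h))
        simp only [ε, s, Sum.elim_inl, Sum.elim_inr, LinearMap.sub_apply, trHerm_apply,
          coordLin_apply] at this
        linarith
      · simpa [ε, s] using hε (.inr (.inr (.inl ⟨u, hu⟩)))
      · simpa [ε, s] using hε (.inr (.inr (.inr ⟨u, hu⟩)))
      · have := hα (.inl n)
        simp only [α, r, Sum.elim_inl, LinearMap.neg_apply, trHerm_apply] at this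
        linarith
      · have := hα (.inr (.inl n))
        simp only [α, r, Sum.elim_inl, Sum.elim_inr, trHerm_apply] at this
        linarith
      · simpa [α, r] using hα (.inr (.inr (.inl h)))
      · have := hα (.inr (.inr (.inr h)))
        simp only [α, r, Sum.elim_inr, coordLin_apply] at this
        linarith)
  let m : D.Multipliers :=
    { μ := fun h => κ (.inl h)
      μbar := fun h => κ (.inr (.inl h))
      ξ := fun u => κ (.inr (.inr (.inl u)))
      ξbar := fun u => κ (.inr (.inr (.inr u)))
      φ := fun n => l (.inl n)
      φbar := fun n => l (.inr (.inl n))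
      γ := γ
      ν := fun h => l (.inr (.inr (.inl h)))
      νbar := fun h => l (.inr (.inr (.inr h))) }
  have hpos : ∀ x' V', V'.PosDef → D.cost x V ≤ lagrangian m x' V' := by
    intro x' V' hV'
    have hherm : hermPart V' = V' := hermPart_of_isHermitian hV'.isHermitian
    have := hle (x', V') (by simpa only [C, Set.mem_ofPred, hherm] using hV')
    refine this.trans_eq ?_
    simp only [Fintype.sum_sum_type, α, r, ε, s, Sum.elim_inl, Sum.elim_inr, LinearMap.neg_apply,
      LinearMap.add_apply, LinearMap.sub_apply, trHerm_apply, coordLin_apply, hherm, add_zero,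
      lagrangian, m, neg_add_eq_sub, ← sub_eq_add_neg]
    have e1 : ∑ h : {h // h ∈ D.H}, κ (.inl h) * (D.tr (D.Z h) V' + x' h 0 + (D.Pl h - D.Pbar h))
        = ∑ h : {h // h ∈ D.H},
          κ (.inl h) * (D.tr (D.Z h) V' + D.Pl h - D.Pbar h + x' h 0) :=
      Finset.sum_congr rfl fun h _ => by ring
    have e2 : ∑ h : {h // h ∈ D.H}, κ (.inr (.inl h)) * (D.tr (D.Zbar h) V' - x' h 1 + D.Ql h)
        = ∑ h : {h // h ∈ D.H},
          κ (.inr (.inl h)) * (D.tr (D.Zbar h) V' + D.Ql h - x' h 1) :=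
      Finset.sum_congr rfl fun h _ => by ring
    rw [e1, e2]
    ring
  refine ⟨m, ⟨fun _ => hl _, fun _ => hl _, hγ, fun _ => hl _, fun _ => hl _⟩,
    fun x' V' hV' => ?_⟩
  have hlim : Filter.Tendsto (fun t : ℝ => lagrangian m x' (V' + t • (1 : D.CMat))) (𝓝[>] 0)
      (𝓝 (lagrangian m x' V')) := by
    have hc : Continuous fun t : ℝ => lagrangian m x' (V' + t • (1 : D.CMat)) :=
      (D.continuous_lagrangian_right m x').comp (by fun_prop)
    have := (hc.tendsto 0).mono_left (nhdsWithin_le_nhds (s := Set.Ioi 0))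
    simpa using this
  refine ge_of_tendsto hlim ?_
  filter_upwards [self_mem_nhdsWithin] with t ht
  exact hpos x' _ (PosDef.posSemidef_add hV' (PosDef.one.smul ht))

variable {D}

theorem lagrangian_le_cost {m : D.Multipliers} (hm : m.Nonneg) {x : D.SetPoints} {V : D.CMat}
    (h : D.Feasible x V) : lagrangian m x V ≤ D.cost x V := by
  have e1 : ∑ h : {h // h ∈ D.H}, m.μ h * (D.tr (D.Z h) V + D.Pl h - D.Pbar h + x h 0) = 0 :=
    Finset.sum_eq_zero fun k _ => by rw [h.active k]; ring
  have e2 : ∑ h : {h // h ∈ D.H}, m.μbar h * (D.tr (D.Zbar h) V + D.Ql h - x h 1) = 0 :=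
    Finset.sum_eq_zero fun k _ => by rw [h.reactive k]; ring
  have e3 : ∑ u : {u // u ∈ D.U}, m.ξ u * D.tr (D.Z u) V = 0 :=
    Finset.sum_eq_zero fun u _ => by rw [h.pole_active u u.2, mul_zero]
  have e4 : ∑ u : {u // u ∈ D.U}, m.ξbar u * D.tr (D.Zbar u) V = 0 :=
    Finset.sum_eq_zero fun u _ => by rw [h.pole_reactive u u.2, mul_zero]
  have i1 : ∑ n, m.φ n * (D.Vmin ^ 2 - D.tr (D.M n) V) ≤ 0 :=
    Finset.sum_nonpos fun n _ => mul_nonpos_of_nonneg_of_nonpos (hm.φ n)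
      (sub_nonpos.2 (h.volt_lower n))
  have i2 : ∑ n, m.φbar n * (D.tr (D.M n) V - D.Vmax ^ 2) ≤ 0 :=
    Finset.sum_nonpos fun n _ => mul_nonpos_of_nonneg_of_nonpos (hm.φbar n)
      (sub_nonpos.2 (h.volt_upper n))
  have i3 : ∑ h : {h // h ∈ D.H}, m.γ h * D.apparent h (x h) ≤ 0 :=
    Finset.sum_nonpos fun k _ => mul_nonpos_of_nonneg_of_nonpos (hm.γ k) (h.rating k)
  have i4 : ∑ h : {h // h ∈ D.H}, m.ν h * (- x h 0) ≤ 0 :=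
    Finset.sum_nonpos fun k _ => mul_nonpos_of_nonneg_of_nonpos (hm.ν k)
      (neg_nonpos.2 (h.curtail_lower k))
  have i5 : ∑ h : {h // h ∈ D.H}, m.νbar h * (x h 0 - D.Pbar h) ≤ 0 :=
    Finset.sum_nonpos fun k _ => mul_nonpos_of_nonneg_of_nonpos (hm.νbar k)
      (sub_nonpos.2 (h.curtail_upper k))
  unfold lagrangian
  linarith

theorem dualFun_le_lagrangian (m : D.Multipliers) (x : D.SetPoints) {V : D.CMat}
    (hV : V.PosSemidef) : dualFun m ≤ ((lagrangian m x V : ℝ) : EReal) :=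
  (iInf_le _ x).trans ((iInf_le _ V).trans (iInf_le _ hV))

theorem le_dualFun_iff {m : D.Multipliers} {p : ℝ} :
    (p : EReal) ≤ dualFun m ↔ ∀ x V, V.PosSemidef → p ≤ lagrangian m x V := by
  simp only [dualFun, le_iInf_iff, EReal.coe_le_coe_iff]

theorem dualFun_le_cost {m : D.Multipliers} (hm : m.Nonneg) {x : D.SetPoints} {V : D.CMat}
    (h : D.Feasible x V) : dualFun m ≤ ((D.cost x V : ℝ) : EReal) :=
  (dualFun_le_lagrangian m x h.psd).trans (EReal.coe_le_coe_iff.2 (lagrangian_le_cost hm h))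

/-- Once some multipliers close the duality gap, so do all optimal ones, and then the bounds
`dualFun m ≤ lagrangian m x V ≤ cost x V` are equalities. -/
theorem IsDualOptimal.dualFun_eq_and_minimizesLagrangian {m m₀ : D.Multipliers}
    (hm : IsDualOptimal m) {x : D.SetPoints} {V : D.CMat} (h : D.Feasible x V)
    (hm₀ : m₀.Nonneg) (hle : ∀ x' V', V'.PosSemidef → D.cost x V ≤ lagrangian m₀ x' V') :
    dualFun m = ((D.cost x V : ℝ) : EReal) ∧ MinimizesLagrangian m x V := by
  have h1 : ((D.cost x V : ℝ) : EReal) ≤ dualFun m :=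
    (le_dualFun_iff.2 hle).trans (hm.2 m₀ hm₀)
  exact ⟨(dualFun_le_cost hm.1 h).antisymm h1, h.psd, fun x' V' hV' =>
    (lagrangian_le_cost hm.1 h).trans (le_dualFun_iff.1 h1 x' V' hV')⟩

end Duality

end DispatchData

/-! ### The subproblem of one inverter -/

namespace DispatchData

section Subproblem

open Matrix

variable {q : Fin 2 → ℝ} {c z : Vec2} {l η : ℝ}

theorem Q_eq_diagonal {D : DispatchData} (m : D.Multipliers) (h : {h // h ∈ D.H}) :
    Q m h = diagonal ![2 * (D.cφ * D.a h) + 2 * m.γ h, 2 * m.γ h] := by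
  ext i j
  fin_cases i <;> fin_cases j <;> simp [Q, A]

theorem norm_sq_eq_sum (x : Vec2) : ‖x‖ ^ 2 = ∑ i, x i ^ 2 := by
  simp [EuclideanSpace.norm_sq_eq]

theorem subObj_diagonal (q : Fin 2 → ℝ) (c : Vec2) (l : ℝ) (x : Vec2) :
    subObj (diagonal q) c l x = ∑ i, (q i * x i ^ 2 / 2 + c i * x i) + l * ‖x‖ := by
  simp only [subObj, quad, mulVec_diagonal, dotProduct, Fin.sum_univ_two]
  ring

theorem dot_ge_neg_norm_mul_norm (c x : Vec2) : -(‖c‖ * ‖x‖) ≤ ∑ i, c i * x i := by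
  have h := (abs_le.1 (abs_real_inner_le_norm c x)).1
  refine h.trans_eq ?_
  simp [PiLp.inner_apply, mul_comm]

theorem subObj_ge (hq : ∀ i, 0 ≤ q i) (x : Vec2) :
    (l - ‖c‖) * ‖x‖ ≤ subObj (diagonal q) c l x := by
  rw [subObj_diagonal, Finset.sum_add_distrib]
  have h1 : 0 ≤ ∑ i, q i * x i ^ 2 / 2 := Finset.sum_nonneg fun i _ => by
    have := hq i
    positivity
  linarith [dot_ge_neg_norm_mul_norm c x]

theorem subObj_diagonal_zero : subObj (diagonal q) c l 0 = 0 := by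
  simp [subObj_diagonal]

theorem isSubMin_zero (hq : ∀ i, 0 ≤ q i) (hc : ‖c‖ ≤ l) : IsSubMin (diagonal q) c l 0 := by
  intro x
  rw [subObj_diagonal_zero]
  exact (mul_nonneg (sub_nonneg.2 hc) (norm_nonneg x)).trans (subObj_ge hq x)

/-- Above the threshold the objective decreases from zero in the direction `-c`. -/
theorem not_isSubMin_zero (hq : ∀ i, 0 ≤ q i) (hl : 0 ≤ l) (hc : l < ‖c‖) :
    ¬ IsSubMin (diagonal q) c l 0 := by
  intro h
  set K := ∑ i, q i * c i ^ 2 / 2 with hK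
  have hK0 : 0 ≤ K := Finset.sum_nonneg fun i _ => by
    have := hq i
    positivity
  have hval : ∀ s : ℝ, 0 ≤ s → 0 ≤ s ^ 2 * K - s * (‖c‖ * (‖c‖ - l)) := by
    intro s hs
    have h1 := h ((-s) • c)
    rw [subObj_diagonal_zero, subObj_diagonal, norm_smul, norm_neg, Real.norm_of_nonneg hs] at h1
    have h2 : ∑ i, (q i * ((-s) • c) i ^ 2 / 2 + c i * ((-s) • c) i)
        = s ^ 2 * K - s * ‖c‖ ^ 2 := by
      rw [hK, norm_sq_eq_sum, Finset.mul_sum, Finset.mul_sum, ← Finset.sum_sub_distrib]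
      refine Finset.sum_congr rfl fun i _ => ?_
      simp only [PiLp.smul_apply, smul_eq_mul]
      ring
    rw [h2] at h1
    linarith
  have hP : 0 < ‖c‖ * (‖c‖ - l) := mul_pos (hl.trans_lt hc) (sub_pos.2 hc)
  set P := ‖c‖ * (‖c‖ - l)
  have hs : 0 < P / (K + 1) := by positivity
  have h1 := hval (P / (K + 1)) hs.le
  have h2 : P / (K + 1) * (K + 1) = P := div_mul_cancel₀ _ (by positivity)
  have h3 : (P / (K + 1)) ^ 2 * K - P / (K + 1) * P = -(P / (K + 1)) ^ 2 := by
    nth_rewrite 3 [← h2]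
    ring
  rw [h3] at h1
  linarith [pow_pos hs 2]

/-- The stationarity condition at a nonzero minimizer `z`. By the inequality of arithmetic and
geometric means, `‖x‖ ≤ (‖x‖² / ‖z‖ + ‖z‖) / 2` with equality at `z`, so `z` also minimizes the
quadratic function obtained from the objective by this replacement. -/
theorem IsSubMin.stationary (hq : ∀ i, 0 ≤ q i) (hl : 0 < l) (h : IsSubMin (diagonal q) c l z)
    (hz : z ≠ 0) (i : Fin 2) : (q i + l / ‖z‖) * z i = -c i := by
  have hn : 0 < ‖z‖ := norm_pos_iff.2 hz
  have hmaj : ∀ x : Vec2, subObj (diagonal q) c l x ≤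
      ∑ i, ((q i + l / ‖z‖) * x i ^ 2 / 2 + c i * x i) + l * ‖z‖ / 2 := by
    intro x
    have h1 : ∑ i, ((q i + l / ‖z‖) * x i ^ 2 / 2 + c i * x i)
        = ∑ i, (q i * x i ^ 2 / 2 + c i * x i) + l * (‖x‖ ^ 2 / ‖z‖) / 2 := by
      rw [norm_sq_eq_sum x]
      simp only [Fin.sum_univ_two]
      ring
    have h2 : 2 * ‖x‖ ≤ ‖x‖ ^ 2 / ‖z‖ + ‖z‖ := by
      have : ‖x‖ ^ 2 / ‖z‖ + ‖z‖ - 2 * ‖x‖ = (‖x‖ - ‖z‖) ^ 2 / ‖z‖ := by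
        field_simp
        ring
      linarith [div_nonneg (sq_nonneg (‖x‖ - ‖z‖)) hn.le]
    rw [subObj_diagonal, h1]
    linarith [mul_le_mul_of_nonneg_left h2 hl.le]
  have heq : subObj (diagonal q) c l z =
      ∑ i, ((q i + l / ‖z‖) * z i ^ 2 / 2 + c i * z i) + l * ‖z‖ / 2 := by
    have h1 : ∑ i, ((q i + l / ‖z‖) * z i ^ 2 / 2 + c i * z i)
        = ∑ i, (q i * z i ^ 2 / 2 + c i * z i) + l * (‖z‖ ^ 2 / ‖z‖) / 2 := by
      rw [norm_sq_eq_sum z]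
      simp only [Fin.sum_univ_two]
      ring
    rw [subObj_diagonal, h1, pow_two, mul_div_cancel_right₀ _ hn.ne']
    ring
  set d := q i + l / ‖z‖ with hd
  have hdpos : 0 < d := add_pos_of_nonneg_of_pos (hq i) (div_pos hl hn)
  set G := d * z i + c i with hG
  -- the minimum of the quadratic function in the coordinate direction `i`
  set t := -G / d with ht
  have h1 := (h (z + t • EuclideanSpace.single i 1)).trans (hmaj _)
  rw [heq] at h1
  have h2 : ∑ j, ((q j + l / ‖z‖) * (z + t • EuclideanSpace.single i (1 : ℝ)) j ^ 2 / 2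
        + c j * (z + t • EuclideanSpace.single i (1 : ℝ)) j)
      = ∑ j, ((q j + l / ‖z‖) * z j ^ 2 / 2 + c j * z j) + (d * t ^ 2 / 2 + t * G) := by
    have : d * t ^ 2 / 2 + t * G
        = ∑ j, if j = i then (q j + l / ‖z‖) * t ^ 2 / 2 + t * ((q j + l / ‖z‖) * z j + c j)
          else 0 := by
      simp [hd, hG]
    rw [this, ← Finset.sum_add_distrib]
    refine Finset.sum_congr rfl fun j _ => ?_
    by_cases hj : j = i
    · subst hj
      simp
      ring
    · simp [hj]
  rw [h2] at h1
  have h3 : d * t ^ 2 / 2 + t * G = -(G ^ 2 / (2 * d)) := by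
    rw [ht]
    field_simp
    ring
  have h4 : G ^ 2 / (2 * d) ≤ 0 := by linarith
  have h5 : G ^ 2 ≤ 0 := by
    have := (div_le_iff₀ (by positivity : 0 < 2 * d)).1 h4
    linarith
  have h6 : G = 0 := pow_eq_zero_iff two_ne_zero |>.1 (le_antisymm h5 (sq_nonneg G))
  linarith

theorem shrinkMat_inv_diagonal (hq : ∀ i, 0 ≤ q i) (hl : 0 < l) (hη : 0 ≤ η) :
    (shrinkMat (diagonal q) l η)⁻¹ = diagonal fun i => (η * q i + l ^ 2 / 2)⁻¹ := by
  refine inv_eq_right_inv ?_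
  have h1 : shrinkMat (diagonal q) l η = diagonal fun i => η * q i + l ^ 2 / 2 := by
    ext i j
    by_cases hij : i = j
    · subst hij; simp [shrinkMat]
    · simp [shrinkMat, hij]
  rw [h1, diagonal_mul_diagonal, ← diagonal_one]
  congr 1
  ext i
  have := hq i
  exact mul_inv_cancel₀ (by positivity)

theorem scalarObj_diagonal (hq : ∀ i, 0 ≤ q i) (hl : 0 < l) (hη : 0 ≤ η) :
    scalarObj (diagonal q) c l η = η - η / 2 * ∑ i, c i ^ 2 / (η * q i + l ^ 2 / 2) := by
  rw [scalarObj, shrinkMat_inv_diagonal hq hl hη]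
  simp only [mulVec_diagonal, dotProduct, Fin.sum_univ_two]
  ring

theorem shrink_diagonal_apply (hq : ∀ i, 0 ≤ q i) (hl : 0 < l) (hη : 0 ≤ η) (hc : l < ‖c‖)
    (i : Fin 2) :
    shrink (diagonal q) c l η i = -η * (c i / (η * q i + l ^ 2 / 2)) := by
  rw [shrink, if_pos hc, shrinkMat_inv_diagonal hq hl hη]
  simp only [mulVec_diagonal, Pi.smul_apply, smul_eq_mul]
  ring

/-- With `η = l ‖z‖ / 2` the stationarity condition takes the form of the shrinkage formula. -/
theorem IsSubMin.apply_eq (hq : ∀ i, 0 ≤ q i) (hl : 0 < l) (h : IsSubMin (diagonal q) c l z)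
    (hz : z ≠ 0) (i : Fin 2) :
    z i = -(l * ‖z‖ / 2) * (c i / (l * ‖z‖ / 2 * q i + l ^ 2 / 2)) := by
  have hn : 0 < ‖z‖ := norm_pos_iff.2 hz
  have hqi := hq i
  have hden : 0 < l * ‖z‖ / 2 * q i + l ^ 2 / 2 := by positivity
  have h1 := h.stationary hq hl hz i
  have h2 : l * ‖z‖ / 2 * q i + l ^ 2 / 2 = l * ‖z‖ / 2 * (q i + l / ‖z‖) := by
    field_simp
  rw [mul_div_assoc', eq_div_iff hden.ne', h2]
  linear_combination (l * ‖z‖ / 2) * h1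

/-- The derivative of the scalar objective vanishes at `l ‖z‖ / 2`. -/
theorem IsSubMin.sum_eq_one (hq : ∀ i, 0 ≤ q i) (hl : 0 < l) (h : IsSubMin (diagonal q) c l z)
    (hz : z ≠ 0) :
    ∑ i, c i ^ 2 * (l ^ 2 / 4) / (l * ‖z‖ / 2 * q i + l ^ 2 / 2) ^ 2 = 1 := by
  have hn : 0 < ‖z‖ := norm_pos_iff.2 hz
  have h1 : ∀ i, c i ^ 2 * (l ^ 2 / 4) / (l * ‖z‖ / 2 * q i + l ^ 2 / 2) ^ 2
      = z i ^ 2 / ‖z‖ ^ 2 := by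
    intro i
    have hqi := hq i
    have hden : 0 < l * ‖z‖ / 2 * q i + l ^ 2 / 2 := by positivity
    rw [eq_div_iff (by positivity), h.apply_eq hq hl hz i]
    generalize l * ‖z‖ / 2 * q i + l ^ 2 / 2 = d
    ring
  simp only [h1]
  rw [← Finset.sum_div, ← norm_sq_eq_sum, div_self (by positivity)]

/-- A nonzero minimizer can only exist if `l ≤ ‖c‖`, and in the case of equality `Q c = 0`. -/
theorem IsSubMin.le_norm (hq : ∀ i, 0 ≤ q i) (hl : 0 < l) (h : IsSubMin (diagonal q) c l z)
    (hz : z ≠ 0) : l ≤ ‖c‖ ∧ (‖c‖ = l ↔ ∀ i, q i * c i = 0) := by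
  have hn : 0 < ‖z‖ := norm_pos_iff.2 hz
  have h1 := h.sum_eq_one hq hl hz
  have hdiff : ∀ i, c i ^ 2 / l ^ 2
      - c i ^ 2 * (l ^ 2 / 4) / (l * ‖z‖ / 2 * q i + l ^ 2 / 2) ^ 2
      = (q i * c i) * c i * (‖z‖ / 2 * (l * ‖z‖ / 2 * q i + l ^ 2)) /
        (l * (l * ‖z‖ / 2 * q i + l ^ 2 / 2) ^ 2) := by
    intro i
    have hqi := hq i
    have hden : 0 < l * ‖z‖ / 2 * q i + l ^ 2 / 2 := by positivity
    rw [div_sub_div _ _ (by positivity) (by positivity), div_eq_div_iff (by positivity)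
      (by positivity)]
    ring
  have hnn : ∀ i, 0 ≤ c i ^ 2 / l ^ 2
      - c i ^ 2 * (l ^ 2 / 4) / (l * ‖z‖ / 2 * q i + l ^ 2 / 2) ^ 2 := by
    intro i
    have hqi := hq i
    rw [hdiff i, mul_assoc (q i), ← pow_two]
    positivity
  have hsum : ∑ i, (c i ^ 2 / l ^ 2
      - c i ^ 2 * (l ^ 2 / 4) / (l * ‖z‖ / 2 * q i + l ^ 2 / 2) ^ 2) = ‖c‖ ^ 2 / l ^ 2 - 1 := by
    rw [Finset.sum_sub_distrib, h1, ← Finset.sum_div, norm_sq_eq_sum]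
  have hge : 1 ≤ ‖c‖ ^ 2 / l ^ 2 := by
    have := Finset.sum_nonneg fun i (_ : i ∈ Finset.univ) => hnn i
    linarith
  refine ⟨?_, fun heq i => ?_, fun hqc => ?_⟩
  · rw [le_div_iff₀ (by positivity), one_mul] at hge
    exact (sq_le_sq₀ hl.le (norm_nonneg c)).1 hge
  · rw [heq, div_self (by positivity), sub_self] at hsum
    have h2 := (Finset.sum_eq_zero_iff_of_nonneg fun i _ => hnn i).1 hsum i (Finset.mem_univ i)
    have hqi := hq i
    rw [hdiff i, div_eq_zero_iff, or_iff_left (by positivity), mul_eq_zero,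
      or_iff_left (by positivity)] at h2
    rcases mul_eq_zero.1 h2 with h3 | h3
    · exact h3
    · rw [h3, mul_zero]
  · have h2 : ‖c‖ ^ 2 / l ^ 2 - 1 = 0 := by
      rw [← hsum]
      exact Finset.sum_eq_zero fun i _ => by rw [hdiff i, hqc i]; simp
    have h3 : ‖c‖ ^ 2 = l ^ 2 := by
      rw [← div_eq_one_iff_eq (by positivity)]
      linarith
    exact (sq_eq_sq₀ (norm_nonneg c) hl.le).1 h3

/-- The exact gap of the scalar objective at a point where its derivative vanishes. -/
theorem IsSubMin.scalarObj_sub (hq : ∀ i, 0 ≤ q i) (hl : 0 < l) (h : IsSubMin (diagonal q) c l z)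
    (hz : z ≠ 0) {t : ℝ} (ht : 0 ≤ t) :
    scalarObj (diagonal q) c l t - scalarObj (diagonal q) c l (l * ‖z‖ / 2)
      = ∑ i, q i * c i ^ 2 * (l ^ 2 / 4) * (t - l * ‖z‖ / 2) ^ 2 /
        ((t * q i + l ^ 2 / 2) * (l * ‖z‖ / 2 * q i + l ^ 2 / 2) ^ 2) := by
  have hn : 0 < ‖z‖ := norm_pos_iff.2 hz
  have h1 := h.sum_eq_one hq hl hz
  have hη : 0 ≤ l * ‖z‖ / 2 := by positivity
  rw [scalarObj_diagonal hq hl ht, scalarObj_diagonal hq hl hη]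
  obtain ⟨η, hηz⟩ : ∃ η, η = l * ‖z‖ / 2 := ⟨_, rfl⟩
  simp only [← hηz] at h1 hη ⊢
  have h2 : ∀ i, q i * c i ^ 2 * (l ^ 2 / 4) * (t - η) ^ 2 /
        ((t * q i + l ^ 2 / 2) * (η * q i + l ^ 2 / 2) ^ 2)
      = (t - η) * (c i ^ 2 * (l ^ 2 / 4) / (η * q i + l ^ 2 / 2) ^ 2)
        - t / 2 * (c i ^ 2 / (t * q i + l ^ 2 / 2))
        + η / 2 * (c i ^ 2 / (η * q i + l ^ 2 / 2)) := by
    intro i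
    have hqi := hq i
    have d1 : 0 < t * q i + l ^ 2 / 2 := by positivity
    have d2 : 0 < η * q i + l ^ 2 / 2 := by positivity
    generalize hd : t * q i + l ^ 2 / 2 = d at d1 ⊢
    generalize he : η * q i + l ^ 2 / 2 = e at d2 ⊢
    field_simp
    rw [← hd, ← he]
    ring
  simp only [h2, Finset.sum_add_distrib, Finset.sum_sub_distrib, ← Finset.mul_sum]
  rw [h1]
  ring

/-- Above the threshold the scalar problem has the only solution `l ‖z‖ / 2`. -/
theorem IsSubMin.isScalarSol_iff (hq : ∀ i, 0 ≤ q i) (hl : 0 < l)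
    (h : IsSubMin (diagonal q) c l z) (hc : l < ‖c‖) (t : ℝ) :
    IsScalarSol (diagonal q) c l t ↔ t = l * ‖z‖ / 2 := by
  have hz : z ≠ 0 := by
    rintro rfl
    exact not_isSubMin_zero hq hl.le hc h
  have hn : 0 < ‖z‖ := norm_pos_iff.2 hz
  have hη : 0 ≤ l * ‖z‖ / 2 := by positivity
  have hterm : ∀ t, 0 ≤ t → ∀ i, 0 ≤ q i * c i ^ 2 * (l ^ 2 / 4) * (t - l * ‖z‖ / 2) ^ 2 /
        ((t * q i + l ^ 2 / 2) * (l * ‖z‖ / 2 * q i + l ^ 2 / 2) ^ 2) := fun t ht i => by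
    have := hq i
    positivity
  constructor
  · rintro ⟨ht, hmin⟩
    by_contra hne
    have h1 := h.scalarObj_sub hq hl hz ht
    have h2 : ∑ i, q i * c i ^ 2 * (l ^ 2 / 4) * (t - l * ‖z‖ / 2) ^ 2 /
        ((t * q i + l ^ 2 / 2) * (l * ‖z‖ / 2 * q i + l ^ 2 / 2) ^ 2) = 0 :=
      le_antisymm (by linarith [hmin _ hη]) (Finset.sum_nonneg fun i _ => hterm t ht i)
    have h3 := (Finset.sum_eq_zero_iff_of_nonneg fun i _ => hterm t ht i).1 h2
    refine hc.ne' ((h.le_norm hq hl hz).2.2 fun i => ?_)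
    have h4 := h3 i (Finset.mem_univ i)
    have hqi := hq i
    have hsub : t - l * ‖z‖ / 2 ≠ 0 := sub_ne_zero.2 hne
    rw [div_eq_zero_iff, or_iff_left (by positivity), mul_eq_zero, or_iff_left (by positivity),
      mul_eq_zero, or_iff_left (by positivity)] at h4
    rcases mul_eq_zero.1 h4 with h5 | h5
    · rw [h5, zero_mul]
    · rw [pow_eq_zero_iff two_ne_zero |>.1 h5, mul_zero]
  · rintro rfl
    refine ⟨hη, fun t ht => ?_⟩
    have h1 := h.scalarObj_sub hq hl hz ht
    linarith [Finset.sum_nonneg fun i (_ : i ∈ Finset.univ) => hterm t ht i]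

theorem IsSubMin.eq_shrink (hq : ∀ i, 0 ≤ q i) (hl : 0 < l)
    (h : IsSubMin (diagonal q) c l z) (hc : l < ‖c‖) (hη : IsScalarSol (diagonal q) c l η) :
    z = shrink (diagonal q) c l η := by
  have hz : z ≠ 0 := by
    rintro rfl
    exact not_isSubMin_zero hq hl.le hc h
  obtain rfl := (h.isScalarSol_iff hq hl hc η).1 hη
  ext i
  rw [shrink_diagonal_apply hq hl hη.1 hc]
  exact h.apply_eq hq hl hz i

theorem isScalarSol_zero (hq : ∀ i, 0 ≤ q i) (hl : 0 < l) (hc : ‖c‖ ≤ l) :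
    IsScalarSol (diagonal q) c l 0 := by
  refine ⟨le_rfl, fun t ht => ?_⟩
  rw [scalarObj_diagonal hq hl le_rfl, scalarObj_diagonal hq hl ht]
  have h1 : ∑ i, c i ^ 2 / (t * q i + l ^ 2 / 2) ≤ 2 := by
    calc ∑ i, c i ^ 2 / (t * q i + l ^ 2 / 2) ≤ ∑ i, c i ^ 2 / (l ^ 2 / 2) :=
          Finset.sum_le_sum fun i _ => div_le_div_of_nonneg_left (sq_nonneg _) (by positivity)
            (le_add_of_nonneg_left (mul_nonneg ht (hq i)))
      _ = ‖c‖ ^ 2 / (l ^ 2 / 2) := by rw [← Finset.sum_div, norm_sq_eq_sum]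
      _ ≤ 2 := by
        rw [div_le_iff₀ (by positivity)]
        have := pow_le_pow_left₀ (norm_nonneg c) hc 2
        linarith
  have := mul_le_mul_of_nonneg_left h1 (by positivity : 0 ≤ t / 2)
  linarith

theorem IsSubMin.exists_isScalarSol (hq : ∀ i, 0 ≤ q i) (hl : 0 < l)
    (h : IsSubMin (diagonal q) c l z) : ∃ η, IsScalarSol (diagonal q) c l η := by
  rcases le_or_gt ‖c‖ l with hc | hc
  · exact ⟨0, isScalarSol_zero hq hl hc⟩
  · exact ⟨_, (h.isScalarSol_iff hq hl hc _).2 rfl⟩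

theorem IsSubMin.exists_pos_isScalarSol_iff (hq : ∀ i, 0 ≤ q i) (hl : 0 < l)
    (h : IsSubMin (diagonal q) c l z) (hc : l < ‖c‖) :
    ∃ η, 0 < η ∧ ∀ t, IsScalarSol (diagonal q) c l t ↔ t = η := by
  refine ⟨_, ?_, h.isScalarSol_iff hq hl hc⟩
  have : z ≠ 0 := by
    rintro rfl
    exact not_isSubMin_zero hq hl.le hc h
  have := norm_pos_iff.2 this
  positivity

theorem IsSubMin.isSubMin_shrink (hq : ∀ i, 0 ≤ q i) (hl : 0 < l)
    (h : IsSubMin (diagonal q) c l z) (hη : IsScalarSol (diagonal q) c l η) :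
    IsSubMin (diagonal q) c l (shrink (diagonal q) c l η) := by
  rcases le_or_gt ‖c‖ l with hc | hc
  · rw [shrink, if_neg (not_lt.2 hc)]
    exact isSubMin_zero hq hc
  · rwa [← h.eq_shrink hq hl hc hη]

theorem mulVec_diagonal_eq_zero_iff : diagonal q *ᵥ c.ofLp = 0 ↔ ∀ i, q i * c i = 0 := by
  simp only [funext_iff, mulVec_diagonal, Pi.zero_apply]

theorem IsSubMin.eq_zero (hq : ∀ i, 0 ≤ q i) (hl : 0 < l) (h : IsSubMin (diagonal q) c l z)
    (htie : ‖c‖ ≠ l ∨ diagonal q *ᵥ c.ofLp ≠ 0) (hc : ‖c‖ ≤ l) : z = 0 := by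
  by_contra hz
  obtain ⟨h1, h2⟩ := h.le_norm hq hl hz
  have h3 : ‖c‖ = l := le_antisymm hc h1
  rcases htie with h4 | h4
  · exact h4 h3
  · exact h4 (mulVec_diagonal_eq_zero_iff.2 (h2.1 h3))

theorem IsSubMin.eq_shrink_of_not_tie (hq : ∀ i, 0 ≤ q i) (hl : 0 < l)
    (h : IsSubMin (diagonal q) c l z) (htie : ‖c‖ ≠ l ∨ diagonal q *ᵥ c.ofLp ≠ 0)
    (hη : IsScalarSol (diagonal q) c l η) : z = shrink (diagonal q) c l η := by
  rcases le_or_gt ‖c‖ l with hc | hc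
  · rw [shrink, if_neg (not_lt.2 hc)]
    exact h.eq_zero hq hl htie hc
  · exact h.eq_shrink hq hl hc hη

theorem isSubMin_iff_of_tie (hq : ∀ i, 0 ≤ q i) (hl : 0 < l) (hc : ‖c‖ = l)
    (hqc : diagonal q *ᵥ c.ofLp = 0) (z : Vec2) :
    IsSubMin (diagonal q) c l z ↔ ∃ t : ℝ, 0 ≤ t ∧ z = (-t) • c := by
  rw [mulVec_diagonal_eq_zero_iff] at hqc
  constructor
  · intro h
    by_cases hz : z = 0
    · exact ⟨0, le_rfl, by simp [hz]⟩
    · refine ⟨l * ‖z‖ / 2 / (l ^ 2 / 2), by positivity, ?_⟩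
      ext i
      rw [h.apply_eq hq hl hz i, PiLp.smul_apply, smul_eq_mul]
      rcases mul_eq_zero.1 (hqc i) with h0 | h0
      · rw [h0]; ring
      · rw [h0]; ring
  · rintro ⟨t, ht, rfl⟩ x
    have h0 : subObj (diagonal q) c l ((-t) • c) = 0 := by
      rw [subObj_diagonal, norm_smul, norm_neg, Real.norm_of_nonneg ht]
      have h2 : ∑ i, (q i * ((-t) • c) i ^ 2 / 2 + c i * ((-t) • c) i) = -t * ‖c‖ ^ 2 := by
        rw [norm_sq_eq_sum, Finset.mul_sum]
        refine Finset.sum_congr rfl fun i _ => ?_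
        simp only [PiLp.smul_apply, smul_eq_mul]
        linear_combination (t ^ 2 * c i / 2) * hqc i
      rw [h2, hc]
      ring
    rw [h0]
    simpa [subObj_diagonal_zero] using isSubMin_zero hq hc.le x

end Subproblem

section Separation

open Matrix

variable {D : DispatchData}

/-- For fixed `V` the Lagrangian splits into the objectives of the inverters. -/
theorem lagrangian_eq_add_sum_subObj (m : D.Multipliers) (x : D.SetPoints) (V : D.CMat) :
    lagrangian m x V = lagrangian m 0 V
      + ∑ h : {h // h ∈ D.H}, subObj (Q m h) (c m h) D.lam (x h) := by
  have key : ∀ h : {h // h ∈ D.H}, subObj (Q m h) (c m h) D.lam (x h) =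
      (quad (D.A h) (x h) + (D.bvec h).ofLp ⬝ᵥ (x h).ofLp + D.lam * ‖x h‖)
      + m.μ h * x h 0 - m.μbar h * x h 1 + m.γ h * (D.apparent h (x h) - D.apparent h 0)
      + m.ν h * (- x h 0) + m.νbar h * x h 0 := by
    intro h
    rw [Q_eq_diagonal, subObj_diagonal, quad_A, apparent_eq, apparent_eq]
    simp [c, bvec, dvec, dotProduct, Fin.sum_univ_two]
    ring
  simp only [key, lagrangian, cost, Finset.sum_add_distrib, Finset.sum_sub_distrib, mul_add,
    mul_sub, Pi.zero_apply, PiLp.zero_apply, mul_zero, norm_zero, neg_zero, Finset.sum_const_zero,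
    quad, WithLp.ofLp_zero, mulVec_zero, dotProduct_zero]
  ring

theorem MinimizesLagrangian.isSubMin {m : D.Multipliers} {x : D.SetPoints} {V : D.CMat}
    (hmin : MinimizesLagrangian m x V) (h : {h // h ∈ D.H}) :
    IsSubMin (Q m h) (c m h) D.lam (x h) := by
  intro z
  have h1 := hmin.2 (Function.update x h z) V hmin.1
  rw [lagrangian_eq_add_sum_subObj m x, lagrangian_eq_add_sum_subObj m (Function.update x h z),
    ← Finset.add_sum_erase _ _ (Finset.mem_univ h),
    ← Finset.add_sum_erase Finset.univ (fun k => subObj (Q m k) (c m k) D.lam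
      (Function.update x h z k)) (Finset.mem_univ h)] at h1
  have h2 : ∑ k ∈ Finset.univ.erase h, subObj (Q m k) (c m k) D.lam (Function.update x h z k)
      = ∑ k ∈ Finset.univ.erase h, subObj (Q m k) (c m k) D.lam (x k) :=
    Finset.sum_congr rfl fun k hk => by rw [Function.update_of_ne (Finset.ne_of_mem_erase hk)]
  rw [h2, Function.update_self] at h1
  linarith

end Separation

end DispatchData

/-! ### The dispatch theorem -/

theorem mainTheorem1 (D : DispatchData)
    (hcφ : 0 ≤ D.cφ) (ha : ∀ h ∈ D.H, 0 ≤ D.a h) (hlam : 0 ≤ D.lam)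
    (hSlater : D.Slater)
    (x : D.SetPoints) (V : D.CMat) (hopt : D.IsOptimal x V) :
    -- optimal dual variables exist
    (∃ m : D.Multipliers, DispatchData.IsDualOptimal m) ∧
    -- and for all optimal dual variables:
    ∀ m : D.Multipliers, DispatchData.IsDualOptimal m →
      -- zero duality gap
      DispatchData.dualFun m = ((D.cost x V : ℝ) : EReal) ∧
      -- the optimal point minimizes the Lagrangian
      DispatchData.MinimizesLagrangian m x V ∧
      ∀ h : {h // h ∈ D.H},
        -- each set point solves its own subproblem, which is convex
        (DispatchData.Q m h).PosSemidef ∧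
        DispatchData.IsSubMin (DispatchData.Q m h) (DispatchData.c m h) D.lam (x h) ∧
        (0 < D.lam →
          -- the scalar problem is solvable, with a unique and positive solution above threshold
          (∃ η, DispatchData.IsScalarSol (DispatchData.Q m h) (DispatchData.c m h) D.lam η) ∧
          (D.lam < ‖DispatchData.c m h‖ →
            ∃ η, 0 < η ∧ ∀ t,
              DispatchData.IsScalarSol (DispatchData.Q m h) (DispatchData.c m h) D.lam t ↔
                t = η) ∧
          -- the formula always gives a solution of the subproblem
          (∀ η, DispatchData.IsScalarSol (DispatchData.Q m h) (DispatchData.c m h) D.lam η →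
            DispatchData.IsSubMin (DispatchData.Q m h) (DispatchData.c m h) D.lam
              (DispatchData.shrink (DispatchData.Q m h) (DispatchData.c m h) D.lam η)) ∧
          -- outside the degenerate tie the subproblem has only one solution, given by the formula
          (‖DispatchData.c m h‖ ≠ D.lam ∨
              Matrix.mulVec (DispatchData.Q m h) (DispatchData.c m h).ofLp ≠ 0 →
            (∀ z, DispatchData.IsSubMin (DispatchData.Q m h) (DispatchData.c m h) D.lam z →
              z = x h) ∧
            (∀ η, DispatchData.IsScalarSol (DispatchData.Q m h) (DispatchData.c m h) D.lam η →
              x h = DispatchData.shrink (DispatchData.Q m h) (DispatchData.c m h) D.lam η) ∧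
            (‖DispatchData.c m h‖ ≤ D.lam →
              x h = 0 ∧ D.operatingPoint h (x h) = (D.Pbar h, 0))) ∧
          -- in the degenerate tie the solutions of the subproblem form a ray issuing from zero
          (‖DispatchData.c m h‖ = D.lam →
            Matrix.mulVec (DispatchData.Q m h) (DispatchData.c m h).ofLp = 0 →
            ∀ z, DispatchData.IsSubMin (DispatchData.Q m h) (DispatchData.c m h) D.lam z ↔
              ∃ t : ℝ, 0 ≤ t ∧ z = (-t) • DispatchData.c m h)) := by
  obtain ⟨m₀, hm₀, hle⟩ := D.exists_multipliers_cost_le_lagrangian hcφ ha hlam hSlater hopt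
  refine ⟨⟨m₀, hm₀, fun m' hm' => (DispatchData.dualFun_le_cost hm' hopt.1).trans
    (DispatchData.le_dualFun_iff.2 hle)⟩, fun m hm => ?_⟩
  obtain ⟨hgap, hmin⟩ := hm.dualFun_eq_and_minimizesLagrangian hopt.1 hm₀ hle
  refine ⟨hgap, hmin, fun h => ?_⟩
  have hx := hmin.isSubMin h
  rw [DispatchData.Q_eq_diagonal] at hx ⊢
  have hq : ∀ i, 0 ≤ (![2 * (D.cφ * D.a h) + 2 * m.γ h, 2 * m.γ h] : Fin 2 → ℝ) i := by
    have h1 := mul_nonneg hcφ (ha h h.2)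
    have h2 := hm.1.γ h
    intro i
    fin_cases i
    · simp only [Fin.zero_eta, Matrix.cons_val_zero]; positivity
    · simp only [Fin.mk_one, Matrix.cons_val_one, Matrix.cons_val_fin_one]; positivity
  refine ⟨Matrix.PosSemidef.diagonal hq, hx, fun hl => ⟨hx.exists_isScalarSol hq hl,
    hx.exists_pos_isScalarSol_iff hq hl, fun η hη => hx.isSubMin_shrink hq hl hη,
    fun htie => ⟨fun z hz => ?_, fun η hη => hx.eq_shrink_of_not_tie hq hl htie hη,
      fun hc => ?_⟩,
    fun hc hqc z => DispatchData.isSubMin_iff_of_tie hq hl hc hqc z⟩⟩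
  · obtain ⟨η, hη⟩ := hx.exists_isScalarSol hq hl
    rw [hz.eq_shrink_of_not_tie hq hl htie hη, hx.eq_shrink_of_not_tie hq hl htie hη]
  · have h0 := hx.eq_zero hq hl htie hc
    exact ⟨h0, by simp [DispatchData.operatingPoint, h0]⟩
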